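/- Let $N\ge 1$ and $m\ge 2$ be integers. For a non-empty bounded open set $\Omega\subset\mathbb R^N$ (for instance a bounded Lipschitz domain) let $\mathbb H_{m,0}(\Omega)$ be the closure of the real space $C_c^\infty(\Omega)$ with respect to the norm $$\|u\|_m=\Big(\int_{\mathbb R^N}(\log(e+|\xi|))^m|\hat u(\xi)|^2\,d\xi\Big)^{1/2},\qquad \hat u(\xi)=\int_{\mathbb R^N}e^{-ix\cdot\xi}u(x)\,dx,$$ and put $$(u,v)_m=\frac1{(2\pi)^N}\int_{\mathbb R^N}(2\log|\xi|)^m\,\hat u(\xi)\overline{\hat v(\xi)}\,d\xi .$$ A real number $\lambda$ is a Dirichlet eigenvalue in $\Omega$ of the $m$-order logarithmic Laplacian (the operator with Fourier symbol $(2\log|\xi|)^m$) if there is $\phi\in\mathbb H_{m,0}(\Omega)$, $\phi\ne0$, with $(\phi,v)_m=\lambda\int_\Omega\phi v\,dx$ for all $v\in\mathbb H_{m,0}(\Omega)$. Then there is a smallest Dirichlet eigenvalue, denoted $\lambda_{m,1}(\Omega)$, and the following holds; $|\Omega|$ is the Lebesgue measure of $\Omega$. (i) If $m$ is even, then $\lambda_{m,1}(\Omega)\ge0$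 for all $\Omega$. If $m$ is odd, there is $r_0>0$, depending only on $N$ and $m$, such that $\lambda_{m,1}(\Omega)\ge0$ whenever $\Omega$ is contained in a ball of radius $r_0$. Moreover, for every $m\ge2$, $$\liminf_{|\Omega|\to0^+}\ \lambda_{m,1}(\Omega)\Big(\log\frac1{|\Omega|(-\log|\Omega|)}\Big)^{-m}\ \ge\ \Big(\frac2N\Big)^m .$$ (ii) Let $\omega_N$ be the surface measure of the unit sphere of $\mathbb R^N$ and $$a_m=\frac{N^{m+1}}{2^m m}\,\frac{(2\pi)^N}{\omega_N},\qquad b_m=\frac{2^m}{N^m}(m-1)^m+\frac1{N^m}.$$ Let $\tilde\tau_m>1$ be the number such that the function $h_m(\tau)=(\tau/3)^{1/(m-1)}-\log(\tau+e)$ vanishes at $\tilde\tau_m$ and is positive on $(\tilde\tau_m,\infty)$, and let $\tau_0\ge1$ be the number with $\tau_0^{m-1}e^{\tau_0}=\max\{e,\tilde\tau_m\}$ (both exist and are unique). Let $m$ be odd. Then $$D_m:=\max\Big\{\frac{e^{\tau_0}}{a_m}\Big((m-1)^m+\frac1{2^m}\Big)^{\frac{m-1}m},\ \frac1{a_m}\Big(2e^{(m-1)^m+\frac1{2^m}}-\tau_0^{m-1}e^{\tau_0}\Big)\Big\}>0,$$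 and for every $d_m\ge D_m$ and every $\Omega$ with $\lambda_{m,1}(\Omega)<0$, $$\lambda_{m,1}(\Omega)\ \ge\ b_m-d_m|\Omega| .$$ -/

import Mathlib

open MeasureTheory Filter Topology Set
open scoped ContDiff

noncomputable section

namespace LogLap

/-- The space `ℝ^N` with its Euclidean norm and Lebesgue measure. -/
abbrev E (N : ℕ) : Type := EuclideanSpace ℝ (Fin N)

/-- The sets `Ω` in which the Dirichlet problem is posed: bounded, open and non-empty. No regularity
of the boundary and no connectedness is required, so bounded Lipschitz domains are included. -/
def IsBoundedOpen {N : ℕ} (Ω : Set (E N)) : Prop :=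
  IsOpen Ω ∧ Ω.Nonempty ∧ Bornology.IsBounded Ω

/-- The Fourier transform `û(ξ) = ∫ e^{-i x·ξ} u(x) dx`. It is only applied to functions in
`L²(ℝ^N)` that vanish outside a bounded set, which are integrable. -/
def fourierHat {N : ℕ} (u : E N → ℝ) (ξ : E N) : ℂ :=
  ∫ x, Complex.exp (-(Complex.I * ((inner ℝ x ξ : ℝ) : ℂ))) * (u x : ℂ)

/-- The square of the norm `‖u‖_m`, that is `∫ (log (e + |ξ|))^m |û(ξ)|² dξ`, in `[0, ∞]`. -/
def normSq {N : ℕ} (m : ℕ) (u : E N → ℝ) : ENNReal :=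
  ∫⁻ ξ, ENNReal.ofReal (Real.log (Real.exp 1 + ‖ξ‖) ^ m * ‖fourierHat u ξ‖ ^ 2)

/-- `C_c^∞(Ω)`, real-valued. -/
def IsTestFunction {N : ℕ} (Ω : Set (E N)) (φ : E N → ℝ) : Prop :=
  ContDiff ℝ ∞ φ ∧ HasCompactSupport φ ∧ tsupport φ ⊆ Ω

/-- `u` (a representative of a class of functions modulo null sets) belongs to `H_{m,0}(Ω)`, the
closure of `C_c^∞(Ω)` with respect to `‖·‖_m`. -/
def MemH {N : ℕ} (m : ℕ) (Ω : Set (E N)) (u : E N → ℝ) : Prop :=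
  MemLp u 2 volume ∧ (∀ᵐ x ∂(volume : Measure (E N)), x ∉ Ω → u x = 0) ∧
    ∃ φ : ℕ → E N → ℝ, (∀ n, IsTestFunction Ω (φ n)) ∧
      Tendsto (fun n => normSq m (fun x => u x - φ n x)) atTop (𝓝 0)

/-- The bilinear form `(u, v)_m = (2π)^{-N} ∫ (2 log |ξ|)^m û(ξ) conj(v̂(ξ)) dξ` of the operator with
Fourier symbol `(2 log |ξ|)^m`. For real-valued `u` and `v` the imaginary part of the integrand is
odd in `ξ`, so only the real part contributes. -/
def form {N : ℕ} (m : ℕ) (u v : E N → ℝ) : ℝ :=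
  ((2 * Real.pi) ^ N)⁻¹ *
    ∫ ξ, (2 * Real.log ‖ξ‖) ^ m * (fourierHat u ξ * (starRingEnd ℂ) (fourierHat v ξ)).re

/-- `μ` is a Dirichlet eigenvalue in `Ω` of the logarithmic Laplacian of order `m`: there is a
non-zero `φ ∈ H_{m,0}(Ω)` with `(φ, v)_m = μ ∫_Ω φ v` for all `v ∈ H_{m,0}(Ω)`. -/
def IsEigenvalue {N : ℕ} (m : ℕ) (Ω : Set (E N)) (μ : ℝ) : Prop :=
  ∃ φ : E N → ℝ, MemH m Ω φ ∧ ¬ (φ =ᵐ[(volume : Measure (E N))] 0) ∧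
    ∀ v : E N → ℝ, MemH m Ω v → form m φ v = μ * ∫ x in Ω, φ x * v x

/-- The first (smallest) Dirichlet eigenvalue `λ_{m,1}(Ω)`. -/
def firstEigenvalue {N : ℕ} (m : ℕ) (Ω : Set (E N)) : ℝ :=
  sInf {μ : ℝ | IsEigenvalue m Ω μ}

/-- The surface measure `ω_N` of the unit sphere of `ℝ^N`. -/
def sphereArea (N : ℕ) : ℝ :=
  (volume : Measure (E N)).toSphere.real univ

/-- `a_m = N^{m+1} (2π)^N / (2^m m ω_N)`. -/
def aConst (N m : ℕ) : ℝ :=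
  (N : ℝ) ^ (m + 1) / (2 ^ m * m) * ((2 * Real.pi) ^ N / sphereArea N)

/-- `b_m = (2^m / N^m) (m - 1)^m + 1 / N^m`. -/
def bConst (N m : ℕ) : ℝ :=
  2 ^ m / (N : ℝ) ^ m * ((m : ℝ) - 1) ^ m + 1 / (N : ℝ) ^ m

/-- `h_m(τ) = (τ / 3)^{1/(m-1)} - log (τ + e)`. -/
def hFun (m : ℕ) (τ : ℝ) : ℝ :=
  (τ / 3) ^ (1 / ((m : ℝ) - 1)) - Real.log (τ + Real.exp 1)

/-- `t` is the number `τ̃_m > 1` with `h_m(τ̃_m) = 0` and `h_m > 0` on `(τ̃_m, ∞)`. -/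
def IsTauTilde (m : ℕ) (t : ℝ) : Prop :=
  1 < t ∧ hFun m t = 0 ∧ ∀ τ : ℝ, t < τ → 0 < hFun m τ

/-- `τ₀` is the number `τ₀ ≥ 1` with `τ₀^{m-1} e^{τ₀} = max {e, τ̃_m}`. -/
def IsTauZero (m : ℕ) (τ₀ : ℝ) : Prop :=
  1 ≤ τ₀ ∧ ∃ t : ℝ, IsTauTilde m t ∧ τ₀ ^ (m - 1) * Real.exp τ₀ = max (Real.exp 1) t

/-- The threshold `max {(e^{τ₀} / a_m) ((m-1)^m + 2^{-m})^{(m-1)/m},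
(1 / a_m) (2 e^{(m-1)^m + 2^{-m}} - τ₀^{m-1} e^{τ₀})}` for the constant `d_m`. -/
def dConst (N m : ℕ) (τ₀ : ℝ) : ℝ :=
  max
    (Real.exp τ₀ / aConst N m *
      (((m : ℝ) - 1) ^ m + 1 / 2 ^ m) ^ (((m : ℝ) - 1) / (m : ℝ)))
    (1 / aConst N m *
      (2 * Real.exp (((m : ℝ) - 1) ^ m + 1 / 2 ^ m) - τ₀ ^ (m - 1) * Real.exp τ₀))

end LogLap

end

/-! Two facts about a function `u` supported in `Ω` carry every bound: Plancherel's identity, and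
the pointwise estimate `|û|² ≤ |Ω| ‖u‖²` that Cauchy-Schwarz gives. For a real level `s`, the symbol
is at least `s - (s - symbol)₊`. The first term integrates against `|û|²` by Plancherel, the second
by the pointwise estimate, so the Rayleigh quotient is at least `s - (2π)^{-N} |Ω| ∫ (s - symbol)₊`
(`MemH.le_form`, `le_firstEigenvalue`). The rest is the choice of `s`.

For even `m`, `s = 0` leaves no gap. For small sets, `s = (2 log R)^m` gives a bound uniform in `Ω`
(`exists_symbol_mul_sub_le_firstEigenvalue`): a fixed `R` yields the radius `r₀`, and `R^N =
1/(|Ω|(-log |Ω|))` the asymptotics. For (ii), `s = b_m`: in a logarithmic radial variable the gap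
integral is a Gamma-type integral, bounded in `integral_levelGap_le`, and
`pow_mul_exp_div_le_dConst` compares the result with `D_m`.

Existence of the first eigenvalue is the direct method. The form controls the energy up to an `L²`
term (`exists_energy_le`), and energy-bounded sequences are relatively compact in `L²` because the
weight tends to infinity (`exists_subseq_tendsto_L2`). The parallelogram inequality then upgrades
`L²` convergence of a minimising sequence to convergence in `‖·‖_m`, so the limit lies in the space
and minimises (`exists_minimizer`). -/

namespace LogLap

variable {N : ℕ} {Ω : Set (E N)} {u v : E N → ℝ}

/-! ### Square integrable functions supported in `Ω` -/

/-- Square integrable functions that vanish almost everywhere outside `Ω`. -/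
structure SuppL2 (Ω : Set (E N)) (u : E N → ℝ) : Prop where
  memLp : MemLp u 2 volume
  zero_off : ∀ᵐ x ∂(volume : Measure (E N)), x ∉ Ω → u x = 0

theorem MemH.suppL2 {m : ℕ} (h : MemH m Ω u) : SuppL2 Ω u := ⟨h.1, h.2.1⟩

namespace SuppL2

theorem add (hu : SuppL2 Ω u) (hv : SuppL2 Ω v) : SuppL2 Ω (fun x => u x + v x) :=
  ⟨hu.memLp.add hv.memLp, by
    filter_upwards [hu.zero_off, hv.zero_off] with x h1 h2 h; simp [h1 h, h2 h]⟩

theorem sub (hu : SuppL2 Ω u) (hv : SuppL2 Ω v) : SuppL2 Ω (fun x => u x - v x) :=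
  ⟨hu.memLp.sub hv.memLp, by
    filter_upwards [hu.zero_off, hv.zero_off] with x h1 h2 h; simp [h1 h, h2 h]⟩

theorem smul (c : ℝ) (hu : SuppL2 Ω u) : SuppL2 Ω (fun x => c * u x) :=
  ⟨hu.memLp.const_mul c, by filter_upwards [hu.zero_off] with x h1 h; simp [h1 h]⟩

theorem integrable_sq (hu : SuppL2 Ω u) : Integrable (fun x => u x ^ 2) := hu.memLp.integrable_sq

theorem integrable_mul (hu : SuppL2 Ω u) (hv : SuppL2 Ω v) : Integrable (fun x => u x * v x) :=
  hu.memLp.integrable_mul hv.memLp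

theorem setIntegral_mul (hΩ : IsBoundedOpen Ω) (hu : SuppL2 Ω u) :
    ∫ x in Ω, u x * v x = ∫ x, u x * v x := by
  rw [← integral_indicator hΩ.1.measurableSet]
  refine integral_congr_ae ?_
  filter_upwards [hu.zero_off] with x h
  by_cases hx : x ∈ Ω
  · simp [hx]
  · simp [hx, h hx]

end SuppL2

theorem IsBoundedOpen.volume_lt_top (hΩ : IsBoundedOpen Ω) : volume Ω < ⊤ :=
  hΩ.2.2.measure_lt_top

theorem IsBoundedOpen.volume_real_pos (hΩ : IsBoundedOpen Ω) : 0 < volume.real Ω :=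
  ENNReal.toReal_pos (hΩ.1.measure_pos volume hΩ.2.1).ne' hΩ.volume_lt_top.ne

/-- The Cauchy-Schwarz inequality against the indicator function of `Ω`. -/
theorem SuppL2.integral_abs_sq_le (hΩ : IsBoundedOpen Ω) (hu : SuppL2 Ω u) :
    Integrable u ∧ (∫ x, |u x|) ^ 2 ≤ volume.real Ω * ∫ x, u x ^ 2 := by
  have hΩm := hΩ.1.measurableSet
  have h1 : MemLp (Ω.indicator fun _ => (1 : ℝ)) 2 (volume : Measure (E N)) :=
    memLp_indicator_const 2 hΩm 1 (Or.inr hΩ.volume_lt_top.ne)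
  have hmul : ∀ᵐ x ∂(volume : Measure (E N)), (Ω.indicator (fun _ => (1 : ℝ)) x) * u x = u x := by
    filter_upwards [hu.zero_off] with x h
    by_cases hx : x ∈ Ω
    · simp [hx]
    · simp [hx, h hx]
  have hint : Integrable u := (h1.integrable_mul hu.memLp).congr hmul
  refine ⟨hint, ?_⟩
  -- Integrating `(t 1_Ω - |u|)² ≥ 0` gives a quadratic in `t`; its nonpositive discriminant is the
  -- claim.
  have h3 : ∀ t : ℝ, 0 ≤ volume.real Ω * (t * t) + (-2 * ∫ x, |u x|) * t + ∫ x, u x ^ 2 := by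
    intro t
    have h4 : 0 ≤ ∫ x, (t * Ω.indicator (fun _ => (1 : ℝ)) x - |u x|) ^ 2 :=
      integral_nonneg fun x => sq_nonneg _
    have h5 : ∫ x, (t * Ω.indicator (fun _ => (1 : ℝ)) x - |u x|) ^ 2 =
        ∫ x, ((t * t) * Ω.indicator (fun _ => (1 : ℝ)) x + (-2 * t) * |u x| + u x ^ 2) := by
      refine integral_congr_ae ?_
      filter_upwards [hu.zero_off] with x h
      by_cases hx : x ∈ Ω
      · simp only [hx, indicator_of_mem]
        rw [← sq_abs (u x)]; ring
      · simp [hx, h hx]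
    have hi : Integrable (Ω.indicator fun _ => (1 : ℝ)) (volume : Measure (E N)) :=
      (integrable_indicator_iff hΩm).2 (integrableOn_const hΩ.volume_lt_top.ne)
    have h6 : ∫ x, ((t * t) * Ω.indicator (fun _ => (1 : ℝ)) x + (-2 * t) * |u x| + u x ^ 2) =
        (∫ x, ((t * t) * Ω.indicator (fun _ => (1 : ℝ)) x + (-2 * t) * |u x|)) + ∫ x, u x ^ 2 :=
      integral_add ((hi.const_mul _).add (hint.abs.const_mul _)) hu.integrable_sq
    rw [h5, h6,
      integral_add (hi.const_mul _) (hint.abs.const_mul _), integral_const_mul, integral_const_mul,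
      integral_indicator hΩm] at h4
    simp only [integral_const, smul_eq_mul, mul_one, measureReal_restrict_apply, MeasurableSet.univ,
      univ_inter] at h4
    linarith
  have := discrim_le_zero h3
  rw [discrim] at this
  linarith

theorem SuppL2.integrable (hΩ : IsBoundedOpen Ω) (hu : SuppL2 Ω u) : Integrable u :=
  (hu.integral_abs_sq_le hΩ).1

/-! ### The Fourier transform and Plancherel's identity -/

section fourier

open scoped FourierTransform SchwartzMap

theorem norm_fourier_kernel (x ξ : E N) :
    ‖Complex.exp (-(Complex.I * ((inner ℝ x ξ : ℝ) : ℂ)))‖ = 1 := by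
  rw [Complex.norm_exp]; simp

theorem integrable_fourier_kernel (hu : Integrable u) (ξ : E N) :
    Integrable fun x => Complex.exp (-(Complex.I * ((inner ℝ x ξ : ℝ) : ℂ))) * (u x : ℂ) := by
  refine (hu.ofReal (𝕜 := ℂ)).bdd_mul (c := 1) ?_ ?_
  · exact (by fun_prop : Continuous fun x : E N =>
      Complex.exp (-(Complex.I * ((inner ℝ x ξ : ℝ) : ℂ)))).aestronglyMeasurable
  · exact .of_forall fun x => (norm_fourier_kernel x ξ).le

theorem fourierHat_add (hu : Integrable u) (hv : Integrable v) (ξ : E N) :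
    fourierHat (fun x => u x + v x) ξ = fourierHat u ξ + fourierHat v ξ := by
  simp only [fourierHat]
  rw [← integral_add (integrable_fourier_kernel hu ξ) (integrable_fourier_kernel hv ξ)]
  congr 1; ext x; push_cast; ring

theorem fourierHat_sub (hu : Integrable u) (hv : Integrable v) (ξ : E N) :
    fourierHat (fun x => u x - v x) ξ = fourierHat u ξ - fourierHat v ξ := by
  simp only [fourierHat]
  rw [← integral_sub (integrable_fourier_kernel hu ξ) (integrable_fourier_kernel hv ξ)]
  congr 1; ext x; push_cast; ring

theorem fourierHat_smul (c : ℝ) (ξ : E N) :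
    fourierHat (fun x => c * u x) ξ = c * fourierHat u ξ := by
  simp only [fourierHat]
  rw [← integral_const_mul]
  congr 1; ext x; push_cast; ring

theorem continuous_fourierHat (hu : Integrable u) : Continuous (fourierHat u) := by
  refine continuous_of_dominated (bound := fun x => ‖u x‖) ?_ ?_ hu.norm ?_
  · exact fun ξ => (integrable_fourier_kernel hu ξ).aestronglyMeasurable
  · refine fun ξ => .of_forall fun x => ?_
    rw [norm_mul, norm_fourier_kernel, one_mul, Complex.norm_real]
  · exact .of_forall fun x => by fun_prop

theorem norm_fourierHat_le (ξ : E N) : ‖fourierHat u ξ‖ ≤ ∫ x, |u x| := by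
  refine (norm_integral_le_integral_norm _).trans_eq ?_
  congr 1; ext x
  rw [norm_mul, norm_fourier_kernel, one_mul, Complex.norm_real, Real.norm_eq_abs]

theorem SuppL2.norm_sq_fourierHat_le (hΩ : IsBoundedOpen Ω) (hu : SuppL2 Ω u) (ξ : E N) :
    ‖fourierHat u ξ‖ ^ 2 ≤ volume.real Ω * ∫ x, u x ^ 2 :=
  (pow_le_pow_left₀ (norm_nonneg _) (norm_fourierHat_le ξ) 2).trans (hu.integral_abs_sq_le hΩ).2

theorem fourierHat_eq_fourier (u : E N → ℝ) (ξ : E N) :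
    fourierHat u ((2 * Real.pi) • ξ) = 𝓕 (fun x => (u x : ℂ)) ξ := by
  rw [Real.fourier_eq', fourierHat]
  congr 1; ext x
  rw [inner_smul_right, smul_eq_mul]
  congr 2
  push_cast; ring

/-- On `L¹ ∩ L²` the Fourier integral represents the `L²` Fourier transform. -/
theorem fourier_toLp_ae_eq {f : E N → ℂ} (h1 : Integrable f) (h2 : MemLp f 2 volume) :
    (𝓕 (h2.toLp f) : Lp ℂ 2 (volume : Measure (E N))) =ᵐ[volume] 𝓕 f := by
  have hcont : Continuous (𝓕 f) :=
    VectorFourier.fourierIntegral_continuous (μ := volume) (L := innerₗ (E N))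
      Real.continuous_fourierChar (by exact continuous_inner) h1
  -- Both sides are locally integrable, so testing against smooth compactly supported `g` suffices.
  -- On such `g` each side moves the transform onto `g`: one through tempered distributions, the
  -- other by Fubini.
  refine ae_eq_of_integral_contDiff_smul_eq
    ((Lp.memLp _).locallyIntegrable (by norm_num)) hcont.locallyIntegrable fun g hg hgs => ?_
  have hgc : ContDiff ℝ ∞ fun x => (g x : ℂ) := Complex.ofRealCLM.contDiff.comp hg
  have hgcs : HasCompactSupport fun x => (g x : ℂ) := hgs.comp_left (g := Complex.ofReal) rfl
  let G : 𝓢(E N, ℂ) := hgcs.toSchwartzMap hgc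
  have hG : ∀ x, G x = (g x : ℂ) := fun x => rfl
  have e1 : ∫ x, G x • (𝓕 (h2.toLp f) : Lp ℂ 2 (volume : Measure (E N))) x = ∫ x, 𝓕 G x • (h2.toLp f) x := by
    rw [← Lp.toTemperedDistribution_apply, ← Lp.fourier_toTemperedDistribution_eq,
      TemperedDistribution.fourier_apply, Lp.toTemperedDistribution_apply]
  have e2 : ∫ x, 𝓕 G x • (h2.toLp f) x = ∫ x, 𝓕 G x • f x := by
    refine integral_congr_ae ?_
    filter_upwards [h2.coeFn_toLp] with x hx
    rw [hx]
  have e3 : ∫ x, 𝓕 G x • f x = ∫ x, G x • 𝓕 f x := by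
    simpa using! VectorFourier.integral_fourierIntegral_smul_eq_flip (μ := volume) (ν := volume) (L := innerₗ (E N))
      Real.continuous_fourierChar continuous_inner (G.integrable (μ := volume)) h1
  have := e1.trans (e2.trans e3)
  simpa only [hG, smul_eq_mul, Complex.real_smul] using this

theorem integral_norm_sq_fourier {f : E N → ℂ} (h1 : Integrable f) (h2 : MemLp f 2 volume) :
    Integrable (fun ξ => ‖𝓕 f ξ‖ ^ 2) ∧ ∫ ξ, ‖𝓕 f ξ‖ ^ 2 = ∫ x, ‖f x‖ ^ 2 := by
  have hae := fourier_toLp_ae_eq h1 h2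
  have hn : ∀ g : Lp (α := E N) ℂ 2, ‖g‖ ^ 2 = ∫ x, ‖g x‖ ^ 2 := by
    intro g
    rw [norm_sq_eq_re_inner (𝕜 := ℂ), L2.inner_def, ← integral_re (L2.integrable_inner g g)]
    congr 1; ext x
    rw [← norm_sq_eq_re_inner (𝕜 := ℂ)]
  have hm : MemLp (𝓕 f) 2 volume := (memLp_congr_ae hae).1 (Lp.memLp _)
  refine ⟨hm.integrable_norm_pow (by norm_num), ?_⟩
  have h3 : ‖𝓕 (h2.toLp f)‖ ^ 2 = ‖h2.toLp f‖ ^ 2 := by rw [Lp.norm_fourier_eq (h2.toLp f)]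
  rw [hn, hn] at h3
  calc _ = _ := integral_congr_ae (by filter_upwards [hae] with x hx; rw [hx])
    _ = _ := h3
    _ = _ := integral_congr_ae (by filter_upwards [h2.coeFn_toLp] with x hx; rw [hx])

/-- The substitution `ξ ↦ 2πξ` passes to the unitary normalisation of the transform and produces the
factor `(2π)^N`. -/
theorem SuppL2.integral_norm_sq_fourierHat (hΩ : IsBoundedOpen Ω) (hu : SuppL2 Ω u) :
    Integrable (fun ξ => ‖fourierHat u ξ‖ ^ 2) ∧
      ∫ ξ, ‖fourierHat u ξ‖ ^ 2 = (2 * Real.pi) ^ N * ∫ x, u x ^ 2 := by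
  have hi := hu.integrable hΩ
  obtain ⟨h1, h2⟩ := integral_norm_sq_fourier (hi.ofReal (𝕜 := ℂ)) hu.memLp.ofReal
  have hpi : 0 < 2 * Real.pi := by positivity
  have h3 : (fun ξ => ‖𝓕 (fun x => (u x : ℂ)) ξ‖ ^ 2) =
      fun ξ => ‖fourierHat u ((2 * Real.pi) • ξ)‖ ^ 2 := by
    ext ξ; rw [fourierHat_eq_fourier]
  have h4 := Measure.integral_comp_smul (volume : Measure (E N))
    (fun ξ => ‖fourierHat u ξ‖ ^ 2) (2 * Real.pi)
  simp only [RCLike.ofReal_eq_complex_ofReal] at h1 h2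
  rw [h3] at h1
  refine ⟨(integrable_comp_smul_iff volume (fun ξ => ‖fourierHat u ξ‖ ^ 2) hpi.ne').1 h1, ?_⟩
  have h5 : ∫ ξ, ‖𝓕 (fun x => (u x : ℂ)) ξ‖ ^ 2 = ∫ x, u x ^ 2 := by
    simpa using h2
  rw [h3, h4, finrank_euclideanSpace_fin, abs_of_pos (by positivity), smul_eq_mul] at h5
  rw [← h5, mul_inv_cancel_left₀ (by positivity)]

end fourier
end LogLap

/-! ### The weighted norm and the space `H_{m,0}(Ω)` -/

namespace LogLap

variable {N m : ℕ} {Ω : Set (E N)} {u v : E N → ℝ}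

/-- The weight `(log (e + r))^m` of the norm `‖·‖_m`. -/
noncomputable def logWeight (m : ℕ) (r : ℝ) : ℝ := Real.log (Real.exp 1 + r) ^ m

theorem one_le_logWeight {r : ℝ} (hr : 0 ≤ r) : 1 ≤ logWeight m r := by
  refine one_le_pow₀ ?_
  rw [Real.le_log_iff_exp_le (by positivity)]
  linarith

theorem logWeight_nonneg {r : ℝ} (hr : 0 ≤ r) : 0 ≤ logWeight m r :=
  zero_le_one.trans (one_le_logWeight hr)

theorem logWeight_mono {r s : ℝ} (hr : 0 ≤ r) (h : r ≤ s) : logWeight m r ≤ logWeight m s := by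
  have h1 : 0 ≤ Real.log (Real.exp 1 + r) := by
    apply Real.log_nonneg; linarith [Real.add_one_le_exp (1 : ℝ)]
  refine pow_le_pow_left₀ h1 (Real.log_le_log (by positivity) (by linarith)) m

theorem continuous_logWeight_norm : Continuous fun ξ : E N => logWeight m ‖ξ‖ := by
  unfold logWeight
  refine Continuous.pow (Continuous.log (by fun_prop) fun ξ => ?_) m
  positivity

theorem normSq_eq (m : ℕ) (u : E N → ℝ) :
    normSq m u = ∫⁻ ξ, ENNReal.ofReal (logWeight m ‖ξ‖ * ‖fourierHat u ξ‖ ^ 2) := rfl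

theorem continuous_weighted (hu : Integrable u) :
    Continuous fun ξ : E N => logWeight m ‖ξ‖ * ‖fourierHat u ξ‖ ^ 2 :=
  continuous_logWeight_norm.mul ((continuous_fourierHat hu).norm.pow 2)

theorem weighted_nonneg (ξ : E N) : 0 ≤ logWeight m ‖ξ‖ * ‖fourierHat u ξ‖ ^ 2 :=
  mul_nonneg (logWeight_nonneg (norm_nonneg _)) (by positivity)

theorem integrable_weighted (hu : Integrable u) (h : normSq m u < ⊤) :
    Integrable fun ξ : E N => logWeight m ‖ξ‖ * ‖fourierHat u ξ‖ ^ 2 := by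
  refine ⟨(continuous_weighted hu).aestronglyMeasurable, ?_⟩
  rw [hasFiniteIntegral_iff_ofReal (.of_forall weighted_nonneg)]
  exact h

theorem normSq_eq_ofReal (hu : Integrable u) (h : normSq m u < ⊤) :
    normSq m u = ENNReal.ofReal (∫ ξ : E N, logWeight m ‖ξ‖ * ‖fourierHat u ξ‖ ^ 2) := by
  rw [ofReal_integral_eq_lintegral_ofReal (integrable_weighted hu h) (.of_forall weighted_nonneg)]
  rfl

theorem normSq_smul (c : ℝ) (u : E N → ℝ) :
    normSq m (fun x => c * u x) = ENNReal.ofReal (c ^ 2) * normSq m u := by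
  rw [normSq_eq, normSq_eq, ← lintegral_const_mul' _ _ ENNReal.ofReal_ne_top]
  congr 1; ext ξ
  rw [fourierHat_smul, ← ENNReal.ofReal_mul (sq_nonneg c), norm_mul, Complex.norm_real, mul_pow,
    Real.norm_eq_abs, sq_abs]
  congr 1; ring

theorem normSq_add_le (hu : Integrable u) (hv : Integrable v) :
    normSq m (fun x => u x + v x) ≤ 2 * normSq m u + 2 * normSq m v := by
  rw [normSq_eq, normSq_eq, normSq_eq, ← lintegral_const_mul' _ _ (by norm_num),
    ← lintegral_const_mul' _ _ (by norm_num), ← lintegral_add_left]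
  · refine lintegral_mono fun ξ => ?_
    rw [fourierHat_add hu hv]
    have h2 : (2 : ENNReal) = ENNReal.ofReal 2 := by simp
    simp only [h2]
    rw [← ENNReal.ofReal_mul (by norm_num), ← ENNReal.ofReal_mul (by norm_num),
      ← ENNReal.ofReal_add (by have := @weighted_nonneg N m u ξ; positivity)
        (by have := @weighted_nonneg N m v ξ; positivity)]
    refine ENNReal.ofReal_le_ofReal ?_
    have h3 : ‖fourierHat u ξ + fourierHat v ξ‖ ^ 2 ≤
        2 * ‖fourierHat u ξ‖ ^ 2 + 2 * ‖fourierHat v ξ‖ ^ 2 := by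
      have := pow_le_pow_left₀ (norm_nonneg _) (norm_add_le (fourierHat u ξ) (fourierHat v ξ)) 2
      nlinarith [sq_nonneg (‖fourierHat u ξ‖ - ‖fourierHat v ξ‖)]
    nlinarith [logWeight_nonneg (m := m) (norm_nonneg ξ)]
  · exact ((continuous_weighted hu).measurable.ennreal_ofReal).const_mul _

theorem normSq_sub_le (hu : Integrable u) (hv : Integrable v) :
    normSq m (fun x => u x - v x) ≤ 2 * normSq m u + 2 * normSq m v := by
  have h := normSq_add_le (m := m) hu (hv.const_mul (-1))
  rw [normSq_smul] at h
  simpa [sub_eq_add_neg] using h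

/-- Fatou's lemma for `‖·‖_m`. -/
theorem normSq_le_of_tendsto {w : ℕ → E N → ℝ} (hw : ∀ k, Integrable (w k))
    (hlim : ∀ ξ, Tendsto (fun k => fourierHat (w k) ξ) atTop (𝓝 (fourierHat u ξ)))
    {b : ℕ → ENNReal} {B : ENNReal} (hb : ∀ᶠ k in atTop, normSq m (w k) ≤ b k)
    (hB : Tendsto b atTop (𝓝 B)) : normSq m u ≤ B := by
  calc normSq m u = ∫⁻ ξ, liminf
        (fun k => ENNReal.ofReal (logWeight m ‖ξ‖ * ‖fourierHat (w k) ξ‖ ^ 2)) atTop := by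
        rw [normSq_eq]
        congr 1; ext ξ
        exact (ENNReal.tendsto_ofReal (((hlim ξ).norm.pow 2).const_mul _)).liminf_eq.symm
    _ ≤ liminf (fun k => normSq m (w k)) atTop :=
        lintegral_liminf_le fun k => (continuous_weighted (hw k)).measurable.ennreal_ofReal
    _ ≤ liminf b atTop := liminf_le_liminf hb
    _ = B := hB.liminf_eq

section testFunctions

open scoped FourierTransform SchwartzMap

theorem IsTestFunction.suppL2 {φ : E N → ℝ} (h : IsTestFunction Ω φ) : SuppL2 Ω φ := by
  refine ⟨h.1.continuous.memLp_of_hasCompactSupport h.2.1, .of_forall fun x hx => ?_⟩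
  exact image_eq_zero_of_notMem_tsupport fun hx' => hx (h.2.2 hx')

/-- The weight grows at most like a polynomial of degree `m`, while the transform of a test function
is bounded with all moments integrable. -/
theorem IsTestFunction.normSq_lt_top {φ : E N → ℝ} (h : IsTestFunction Ω φ) :
    normSq m φ < ⊤ := by
  have hgc : ContDiff ℝ ∞ fun x => (φ x : ℂ) := Complex.ofRealCLM.contDiff.comp h.1
  have hgcs : HasCompactSupport fun x => (φ x : ℂ) := h.2.1.comp_left (g := Complex.ofReal) rfl
  let G : 𝓢(E N, ℂ) := hgcs.toSchwartzMap hgc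
  have hint : Integrable φ := h.1.continuous.integrable_of_hasCompactSupport h.2.1
  have hpi : 0 < 2 * Real.pi := by positivity
  have hG : ∀ ξ, fourierHat φ ((2 * Real.pi) • ξ) = (𝓕 G) ξ := fun ξ => by
    rw [fourierHat_eq_fourier, SchwartzMap.fourier_coe]; rfl
  obtain ⟨C, hC0, hC⟩ := (𝓕 G).decay 0 0
  have hC' : ∀ ξ, ‖(𝓕 G) ξ‖ ≤ C := fun ξ => by simpa using hC ξ
  have hmaj : Integrable fun ξ : E N => (2 ^ (m - 1) * Real.exp 1 ^ m * C) * ‖(𝓕 G) ξ‖ +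
      (2 ^ (m - 1) * (2 * Real.pi) ^ m * C) * (‖ξ‖ ^ m * ‖(𝓕 G) ξ‖) :=
    ((𝓕 G).integrable.norm.const_mul _).add
      (((𝓕 G).integrable_pow_mul volume m).const_mul _)
  have h1 : Integrable fun ξ : E N => (fun ξ : E N => logWeight m ‖ξ‖ * ‖fourierHat φ ξ‖ ^ 2)
      ((2 * Real.pi) • ξ) := by
    refine hmaj.mono' ((continuous_weighted hint).comp
      (continuous_const_smul _)).aestronglyMeasurable (.of_forall fun ξ => ?_)
    rw [Real.norm_of_nonneg (weighted_nonneg _)]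
    simp only [hG]
    have h2 : logWeight m ‖(2 * Real.pi) • ξ‖ ≤
        2 ^ (m - 1) * (Real.exp 1 ^ m + ((2 * Real.pi) * ‖ξ‖) ^ m) := by
      rw [norm_smul, Real.norm_of_nonneg hpi.le]
      refine le_trans ?_ (add_pow_le (Real.exp_pos 1).le (by positivity) m)
      refine pow_le_pow_left₀ (Real.log_nonneg ?_) (Real.log_le_self (by positivity)) m
      have : 0 ≤ 2 * Real.pi * ‖ξ‖ := by positivity
      linarith [Real.add_one_le_exp (1 : ℝ)]
    calc logWeight m ‖(2 * Real.pi) • ξ‖ * ‖(𝓕 G) ξ‖ ^ 2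
        ≤ (2 ^ (m - 1) * (Real.exp 1 ^ m + ((2 * Real.pi) * ‖ξ‖) ^ m)) * (C * ‖(𝓕 G) ξ‖) := by
          refine mul_le_mul h2 ?_ (by positivity) (by positivity)
          rw [sq]
          exact mul_le_mul_of_nonneg_right (hC' ξ) (norm_nonneg _)
      _ = _ := by rw [mul_pow]; ring
  have h2 := (integrable_comp_smul_iff volume
    (fun ξ : E N => logWeight m ‖ξ‖ * ‖fourierHat φ ξ‖ ^ 2) hpi.ne').1 h1
  exact (hasFiniteIntegral_iff_ofReal (.of_forall weighted_nonneg)).1 h2.2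

end testFunctions

theorem IsTestFunction.add {φ ψ : E N → ℝ} (h : IsTestFunction Ω φ) (h' : IsTestFunction Ω ψ) :
    IsTestFunction Ω fun x => φ x + ψ x :=
  ⟨h.1.add h'.1, h.2.1.add h'.2.1,
    (tsupport_add φ ψ).trans (union_subset h.2.2 h'.2.2)⟩

theorem IsTestFunction.smul {φ : E N → ℝ} (c : ℝ) (h : IsTestFunction Ω φ) :
    IsTestFunction Ω fun x => c * φ x :=
  ⟨contDiff_const.mul h.1, h.2.1.mul_left, (tsupport_mul_subset_right).trans h.2.2⟩

theorem memH_iff : MemH m Ω u ↔ SuppL2 Ω u ∧ ∃ φ : ℕ → E N → ℝ, (∀ n, IsTestFunction Ω (φ n)) ∧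
    Tendsto (fun n => normSq m (fun x => u x - φ n x)) atTop (𝓝 0) :=
  ⟨fun h => ⟨h.suppL2, h.2.2⟩, fun h => ⟨h.1.1, h.1.2, h.2⟩⟩

theorem normSq_zero : normSq m (fun _ : E N => (0 : ℝ)) = 0 := by
  simp [normSq_eq, fourierHat]

theorem IsTestFunction.memH {φ : E N → ℝ} (h : IsTestFunction Ω φ) : MemH m Ω φ :=
  memH_iff.2 ⟨h.suppL2, fun _ => φ, fun _ => h, by simp [normSq_zero]⟩

theorem MemH.normSq_lt_top (hΩ : IsBoundedOpen Ω) (h : MemH m Ω u) : normSq m u < ⊤ := by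
  obtain ⟨hs, φ, hφ, hlim⟩ := memH_iff.1 h
  obtain ⟨n, hn⟩ := (hlim.eventually (gt_mem_nhds (zero_lt_one (α := ENNReal)))).exists
  have h1 := normSq_add_le (m := m) ((hs.sub (hφ n).suppL2).integrable hΩ)
    ((hφ n).suppL2.integrable hΩ)
  simp only [sub_add_cancel] at h1
  refine h1.trans_lt (ENNReal.add_lt_top.2 ⟨ENNReal.mul_lt_top (by norm_num) (hn.trans (by norm_num)),
    ENNReal.mul_lt_top (by norm_num) (hφ n).normSq_lt_top⟩)

theorem MemH.add (hΩ : IsBoundedOpen Ω) (hu : MemH m Ω u) (hv : MemH m Ω v) :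
    MemH m Ω fun x => u x + v x := by
  obtain ⟨hs, φ, hφ, hlim⟩ := memH_iff.1 hu
  obtain ⟨hs', ψ, hψ, hlim'⟩ := memH_iff.1 hv
  refine memH_iff.2 ⟨hs.add hs', fun n x => φ n x + ψ n x, fun n => (hφ n).add (hψ n), ?_⟩
  have h0 : Tendsto (fun n => 2 * normSq m (fun x => u x - φ n x) +
      2 * normSq m (fun x => v x - ψ n x)) atTop (𝓝 0) := by
    simpa using (ENNReal.Tendsto.const_mul hlim (Or.inr (by norm_num))).add
      (ENNReal.Tendsto.const_mul (a := 2) hlim' (Or.inr (by norm_num)))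
  refine tendsto_of_tendsto_of_tendsto_of_le_of_le tendsto_const_nhds h0 (fun _ => zero_le) fun n => ?_
  have := normSq_add_le (m := m) ((hs.sub (hφ n).suppL2).integrable hΩ)
    ((hs'.sub (hψ n).suppL2).integrable hΩ)
  refine le_of_eq_of_le ?_ this
  congr 1; ext x; ring

theorem MemH.smul (c : ℝ) (hu : MemH m Ω u) : MemH m Ω fun x => c * u x := by
  obtain ⟨hs, φ, hφ, hlim⟩ := memH_iff.1 hu
  refine memH_iff.2 ⟨hs.smul c, fun n x => c * φ n x, fun n => (hφ n).smul c, ?_⟩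
  have h0 : Tendsto (fun n => ENNReal.ofReal (c ^ 2) * normSq m (fun x => u x - φ n x)) atTop
      (𝓝 0) := by
    simpa using ENNReal.Tendsto.const_mul (a := ENNReal.ofReal (c ^ 2)) hlim
      (Or.inr ENNReal.ofReal_ne_top)
  refine h0.congr fun n => ?_
  rw [← normSq_smul]
  congr 1; ext x; ring

theorem MemH.sub (hΩ : IsBoundedOpen Ω) (hu : MemH m Ω u) (hv : MemH m Ω v) :
    MemH m Ω fun x => u x - v x := by
  have := hu.add hΩ (hv.smul (-1))
  simpa [sub_eq_add_neg] using this

/-- The space `H_{m,0}(Ω)` is closed with respect to `‖·‖_m`. -/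
theorem MemH.of_tendsto (hΩ : IsBoundedOpen Ω) (hu : SuppL2 Ω u) {w : ℕ → E N → ℝ}
    (hw : ∀ n, MemH m Ω (w n))
    (hlim : Tendsto (fun n => normSq m (fun x => u x - w n x)) atTop (𝓝 0)) : MemH m Ω u := by
  have hex : ∀ n, ∃ φ, IsTestFunction Ω φ ∧
      normSq m (fun x => w n x - φ x) < ((n : ENNReal) + 1)⁻¹ := fun n => by
    obtain ⟨hs, φ, hφ, hl⟩ := memH_iff.1 (hw n)
    obtain ⟨k, hk⟩ := (hl.eventually (gt_mem_nhds (show 0 < ((n : ENNReal) + 1)⁻¹ by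
      rw [ENNReal.inv_pos]; exact ENNReal.add_ne_top.2 ⟨by simp, by simp⟩))).exists
    exact ⟨φ k, hφ k, hk⟩
  choose φ hφ hlt using hex
  refine memH_iff.2 ⟨hu, φ, hφ, ?_⟩
  have hinv : Tendsto (fun n : ℕ => ((n : ENNReal) + 1)⁻¹) atTop (𝓝 0) := by
    have := (tendsto_add_atTop_iff_nat 1).2 ENNReal.tendsto_inv_nat_nhds_zero
    simpa using this
  have h0 : Tendsto (fun n : ℕ => 2 * normSq m (fun x => u x - w n x) +
      2 * ((n : ENNReal) + 1)⁻¹) atTop (𝓝 0) := by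
    simpa using (ENNReal.Tendsto.const_mul hlim (Or.inr (by norm_num))).add
      (ENNReal.Tendsto.const_mul (a := 2) hinv (Or.inr (by norm_num)))
  refine tendsto_of_tendsto_of_tendsto_of_le_of_le tendsto_const_nhds h0 (fun _ => zero_le) fun n => ?_
  have := normSq_add_le (m := m) ((hu.sub (hw n).suppL2).integrable hΩ)
    (((hw n).suppL2.sub (hφ n).suppL2).integrable hΩ)
  simp only [sub_add_sub_cancel] at this
  refine this.trans ?_
  gcongr
  exact (hlt n).le

/-- Every non-empty open set carries a normalised test function. -/
theorem exists_memH_integral_sq_eq_one (hΩ : IsBoundedOpen Ω) :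
    ∃ u : E N → ℝ, MemH m Ω u ∧ ∫ x, u x ^ 2 = 1 := by
  obtain ⟨x₀, hx₀⟩ := hΩ.2.1
  obtain ⟨f, hf1, hf2, hf3, -, hf4⟩ := exists_contDiff_tsupport_subset (n := ⊤) (hΩ.1.mem_nhds hx₀)
  have hf : IsTestFunction Ω f := ⟨hf3, hf2, hf1⟩
  have hpos : 0 < ∫ x, f x ^ 2 := by
    refine Continuous.integral_pos_of_hasCompactSupport_nonneg_nonzero (x := x₀)
      (hf3.continuous.pow 2) ?_ (fun x => sq_nonneg _) (by simp [hf4])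
    exact hf2.comp_left (g := fun t : ℝ => t ^ 2) (by simp)
  refine ⟨fun x => (√(∫ x, f x ^ 2))⁻¹ * f x, hf.memH.smul _, ?_⟩
  simp only [mul_pow]
  rw [integral_const_mul, inv_pow, Real.sq_sqrt hpos.le, inv_mul_cancel₀ hpos.ne']

end LogLap

/-! ### The symbol, its gap below a level, and the quadratic form -/

namespace LogLap

variable {N m : ℕ} {Ω : Set (E N)} {u v w : E N → ℝ}

/-- The radial profile `(2 log r)^m` of the symbol of the operator. -/
noncomputable def symbol (m : ℕ) (r : ℝ) : ℝ := (2 * Real.log r) ^ m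

theorem measurable_symbol : Measurable (symbol m) := by
  unfold symbol; fun_prop

theorem measurable_symbol_norm : Measurable fun ξ : E N => symbol m ‖ξ‖ :=
  measurable_symbol.comp measurable_norm

theorem nontrivial_E (hN : 1 ≤ N) : Nontrivial (E N) := by
  have : Nonempty (Fin N) := ⟨⟨0, hN⟩⟩
  infer_instance

/-- This is the bound `|log x| x^{1/(2m)} < 2m` raised to the power `m`; the exponent is chosen so
that the majorant `x^{-1/2}` is integrable at the origin. -/
theorem abs_log_pow_le {x : ℝ} (hm : m ≠ 0) (hx : 0 < x) (hx1 : x ≤ 1) :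
    |Real.log x| ^ m ≤ (2 * m) ^ m * x ^ (-(1 / 2) : ℝ) := by
  have hm0 : (0 : ℝ) < m := by positivity
  have h := Real.abs_log_mul_self_rpow_lt x (1 / (2 * m)) hx hx1 (by positivity)
  rw [abs_mul, abs_of_pos (Real.rpow_pos_of_pos hx _), one_div_one_div] at h
  have h2 := pow_le_pow_left₀ (by positivity) h.le m
  rw [mul_pow, ← Real.rpow_natCast (x ^ _), ← Real.rpow_mul hx.le] at h2
  have h3 : 1 / (2 * (m : ℝ)) * m = 1 / 2 := by field_simp
  rw [h3] at h2
  rw [Real.rpow_neg hx.le, ← div_eq_mul_inv, le_div_iff₀ (Real.rpow_pos_of_pos hx _)]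
  exact h2

theorem integrableOn_abs_symbol (hm : m ≠ 0) (R : ℝ) :
    IntegrableOn (fun y => |symbol m y|) (Ioo 0 R) := by
  have h1 : IntegrableOn (fun y => |symbol m y|) (Ioc 0 1) := by
    have hrp : IntegrableOn (fun x : ℝ => (2 ^ m * (2 * m) ^ m) * x ^ (-(1 / 2) : ℝ)) (Ioc 0 1) := by
      have := intervalIntegral.intervalIntegrable_rpow' (a := 0) (b := 1) (r := -(1 / 2))
        (by norm_num)
      rw [intervalIntegrable_iff_integrableOn_Ioc_of_le zero_le_one] at this
      exact this.const_mul _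
    refine hrp.mono' measurable_symbol.abs.aestronglyMeasurable ?_
    filter_upwards [ae_restrict_mem measurableSet_Ioc] with x hx
    rw [Real.norm_eq_abs, abs_abs, symbol, abs_pow, abs_mul, mul_pow, abs_two, mul_assoc]
    exact mul_le_mul_of_nonneg_left (abs_log_pow_le hm hx.1 hx.2) (by positivity)
  have h2 : IntegrableOn (fun y => |symbol m y|) (Icc 1 R) := by
    refine ContinuousOn.integrableOn_Icc ?_
    unfold symbol
    refine ContinuousOn.abs (ContinuousOn.pow (continuousOn_const.mul
      (Real.continuousOn_log.mono fun x hx => ?_)) m)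
    exact (zero_lt_one.trans_le hx.1).ne'
  refine (h1.union h2).mono_set fun x hx => ?_
  rcases le_total x 1 with h | h
  · exact Or.inl ⟨hx.1, h⟩
  · exact Or.inr ⟨h, hx.2.le⟩

theorem integrableOn_abs_symbol_norm (hN : 1 ≤ N) (hm : m ≠ 0) (R : ℝ) :
    IntegrableOn (fun ξ : E N => |symbol m ‖ξ‖|) (Metric.ball 0 R) := by
  have := nontrivial_E hN
  rw [integrableOn_fun_norm_addHaar volume (f := fun r => |symbol m r|)]
  refine Integrable.bdd_mul (c := R ^ (Module.finrank ℝ (E N) - 1))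
    (integrableOn_abs_symbol hm R) (by fun_prop) ?_
  filter_upwards [ae_restrict_mem measurableSet_Ioo] with x hx
  rw [norm_pow, Real.norm_of_nonneg hx.1.le]
  exact pow_le_pow_left₀ hx.1.le hx.2.le _

/-- The part of the level `s` that lies above the symbol. -/
noncomputable def levelGap (m : ℕ) (s r : ℝ) : ℝ := max (s - symbol m r) 0

theorem levelGap_nonneg (s r : ℝ) : 0 ≤ levelGap m s r := le_max_right _ _

theorem measurable_levelGap (s : ℝ) : Measurable (levelGap m s) :=
  (measurable_const.sub measurable_symbol).max measurable_const

/-- Here `log r ≥ 1 + |s|`, so the base `2 log r` exceeds `1` and its `m`-th power is at least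
itself, hence at least `s`. The gap therefore has bounded support, and only the logarithmic
singularity at `0` affects its integrability. -/
theorem levelGap_eq_zero (hm : m ≠ 0) {s r : ℝ} (hr : Real.exp (1 + |s|) ≤ r) :
    levelGap m s r = 0 := by
  have h1 : 1 + |s| ≤ Real.log r := by
    rwa [Real.le_log_iff_exp_le ((Real.exp_pos _).trans_le hr)]
  refine max_eq_right ?_
  have h2 : 2 * Real.log r ≤ symbol m r := le_self_pow₀ (by linarith [abs_nonneg s]) hm
  linarith [le_abs_self s, abs_nonneg s]

theorem integrable_levelGap (hN : 1 ≤ N) (hm : m ≠ 0) (s : ℝ) :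
    Integrable fun ξ : E N => levelGap m s ‖ξ‖ := by
  have hb := integrableOn_abs_symbol_norm (N := N) hN hm (Real.exp (1 + |s|))
  have hc : IntegrableOn (fun _ : E N => |s|) (Metric.ball 0 (Real.exp (1 + |s|))) :=
    integrableOn_const measure_ball_lt_top.ne
  have hsum := (integrable_indicator_iff measurableSet_ball).2 (hc.add hb)
  refine hsum.mono' ((measurable_levelGap s).comp measurable_norm).aestronglyMeasurable
    (.of_forall fun ξ => ?_)
  rw [Real.norm_of_nonneg (levelGap_nonneg _ _)]
  by_cases hξ : ξ ∈ Metric.ball (0 : E N) (Real.exp (1 + |s|))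
  · rw [indicator_of_mem hξ]
    refine max_le ?_ (by simp only [Pi.add_apply]; positivity)
    simp only [Pi.add_apply]
    linarith [le_abs_self s, neg_abs_le (symbol m ‖ξ‖)]
  · rw [indicator_of_notMem hξ, levelGap_eq_zero hm (by simpa using hξ)]

/-- Near `0` the symbol is unbounded while the weight is not, so the part inside the unit ball is
kept apart; it is integrable and is paired with the sup bound on `|û|²`. -/
theorem abs_symbol_le {r : ℝ} (hr : 0 ≤ r) :
    |symbol m r| ≤ 2 ^ m * logWeight m r + (Iio (1 : ℝ)).indicator (fun r => |symbol m r|) r := by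
  rcases lt_or_ge r 1 with h | h
  · rw [indicator_of_mem (by exact h)]
    have := logWeight_nonneg (m := m) hr
    have : 0 ≤ 2 ^ m * logWeight m r := by positivity
    linarith
  · rw [indicator_of_notMem (by simpa using h), add_zero, symbol, abs_pow, logWeight, ← mul_pow]
    have h1 := Real.log_nonneg h
    rw [abs_of_nonneg (by positivity)]
    refine pow_le_pow_left₀ (by positivity) ?_ m
    have := Real.log_le_log (by linarith) (show r ≤ Real.exp 1 + r by linarith [Real.exp_pos 1])
    linarith

/-- For `r ≤ e` one has `e + r ≤ e²`, so the weight is at most `2^m`; for `r ≥ e` one has `e + r ≤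
r²`, so the symbol dominates. `levelGap m 0` is the negative part of the symbol. -/
theorem logWeight_le {r : ℝ} (hr : 0 ≤ r) :
    logWeight m r ≤ 2 ^ m + symbol m r + levelGap m 0 r := by
  have he : 2 ≤ Real.exp 1 := by linarith [Real.add_one_le_exp (1 : ℝ)]
  have h0 : 0 ≤ Real.log (Real.exp 1 + r) := Real.log_nonneg (by linarith)
  rcases le_total r (Real.exp 1) with h | h
  · have h1 : logWeight m r ≤ 2 ^ m := by
      refine pow_le_pow_left₀ h0 ?_ m
      rw [Real.log_le_iff_le_exp (by positivity)]
      have : Real.exp 2 = Real.exp 1 * Real.exp 1 := by rw [← Real.exp_add]; norm_num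
      rw [this]; nlinarith
    have h2 : 0 - symbol m r ≤ levelGap m 0 r := le_max_left _ _
    linarith
  · have h1 : logWeight m r ≤ symbol m r := by
      refine pow_le_pow_left₀ h0 ?_ m
      have : 2 * Real.log r = Real.log (r ^ 2) := by rw [Real.log_pow]; norm_num
      rw [this]
      refine Real.log_le_log (by positivity) (by nlinarith)
    have h2 : 0 ≤ levelGap m 0 r := levelGap_nonneg _ _
    have : (0 : ℝ) < 2 ^ m := by positivity
    linarith

/-- The energy `‖u‖_m²` as a real number. -/
noncomputable def energy (m : ℕ) (u : E N → ℝ) : ℝ :=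
  ∫ ξ : E N, logWeight m ‖ξ‖ * ‖fourierHat u ξ‖ ^ 2

theorem integrable_indicator_symbol (hN : 1 ≤ N) (hm : m ≠ 0) :
    Integrable fun ξ : E N => (Iio (1 : ℝ)).indicator (fun r => |symbol m r|) ‖ξ‖ := by
  refine ((integrable_indicator_iff measurableSet_ball).2
    (integrableOn_abs_symbol_norm hN hm 1)).congr (.of_forall fun ξ => ?_)
  simp [indicator]

theorem integrable_abs_symbol_mul (hN : 1 ≤ N) (hm : m ≠ 0) (hΩ : IsBoundedOpen Ω)
    (hu : SuppL2 Ω u) (h : normSq m u < ⊤) :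
    Integrable fun ξ : E N => |symbol m ‖ξ‖| * ‖fourierHat u ξ‖ ^ 2 := by
  have hi := hu.integrable hΩ
  have h1 := ((integrable_weighted hi h).const_mul (2 ^ m)).add
    ((integrable_indicator_symbol (N := N) hN hm).mul_const (volume.real Ω * ∫ x, u x ^ 2))
  refine h1.mono' (measurable_symbol_norm.abs.mul
    ((continuous_fourierHat hi).norm.pow 2).measurable).aestronglyMeasurable (.of_forall fun ξ => ?_)
  rw [Real.norm_of_nonneg (by positivity)]
  refine (mul_le_mul_of_nonneg_right (abs_symbol_le (norm_nonneg ξ)) (by positivity)).trans ?_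
  simp only [Pi.add_apply]
  rw [add_mul, mul_assoc]
  gcongr
  · exact indicator_nonneg (fun _ _ => abs_nonneg _) _
  · exact hu.norm_sq_fourierHat_le hΩ ξ

theorem MemH.integrable_form (hN : 1 ≤ N) (hm : m ≠ 0) (hΩ : IsBoundedOpen Ω)
    (hu : MemH m Ω u) (hv : MemH m Ω v) :
    Integrable fun ξ : E N =>
      (2 * Real.log ‖ξ‖) ^ m * (fourierHat u ξ * (starRingEnd ℂ) (fourierHat v ξ)).re := by
  have h1 := (integrable_abs_symbol_mul hN hm hΩ hu.suppL2 (hu.normSq_lt_top hΩ)).add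
    (integrable_abs_symbol_mul hN hm hΩ hv.suppL2 (hv.normSq_lt_top hΩ))
  have hcu := continuous_fourierHat (hu.suppL2.integrable hΩ)
  have hcv := continuous_fourierHat (hv.suppL2.integrable hΩ)
  refine h1.mono' ((measurable_symbol_norm (m := m)).mul
    (by fun_prop : Continuous fun ξ => (fourierHat u ξ *
      (starRingEnd ℂ) (fourierHat v ξ)).re).measurable).aestronglyMeasurable (.of_forall fun ξ => ?_)
  simp only [Pi.add_apply]
  rw [Real.norm_eq_abs, abs_mul, ← mul_add]
  refine mul_le_mul_of_nonneg_left ?_ (abs_nonneg _)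
  refine (Complex.abs_re_le_norm _).trans ?_
  rw [norm_mul, Complex.norm_conj]
  nlinarith [sq_nonneg (‖fourierHat u ξ‖ - ‖fourierHat v ξ‖), sq_nonneg ‖fourierHat u ξ‖,
    sq_nonneg ‖fourierHat v ξ‖]

theorem form_comm (u v : E N → ℝ) : form m u v = form m v u := by
  simp only [form]
  congr 2; ext ξ
  simp only [Complex.mul_re, Complex.conj_re, Complex.conj_im]
  ring

theorem form_add_left (hN : 1 ≤ N) (hm : m ≠ 0) (hΩ : IsBoundedOpen Ω) (hu : MemH m Ω u)
    (hv : MemH m Ω v) (hw : MemH m Ω w) :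
    form m (fun x => u x + v x) w = form m u w + form m v w := by
  simp only [form]
  rw [← mul_add, ← integral_add (hu.integrable_form hN hm hΩ hw) (hv.integrable_form hN hm hΩ hw)]
  congr 2; ext ξ
  rw [fourierHat_add (hu.suppL2.integrable hΩ) (hv.suppL2.integrable hΩ), add_mul, Complex.add_re,
    mul_add]

theorem form_smul_left (c : ℝ) (u v : E N → ℝ) : form m (fun x => c * u x) v = c * form m u v := by
  simp only [form]
  rw [mul_left_comm, ← integral_const_mul c]
  congr 2; ext ξ
  rw [fourierHat_smul, mul_assoc, Complex.re_ofReal_mul]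
  ring

theorem form_self (u : E N → ℝ) :
    form m u u = ((2 * Real.pi) ^ N)⁻¹ * ∫ ξ, symbol m ‖ξ‖ * ‖fourierHat u ξ‖ ^ 2 := by
  simp only [form]
  congr 2; ext ξ
  rw [Complex.mul_conj, Complex.ofReal_re, Complex.normSq_eq_norm_sq, symbol]

theorem integral_symbol_mul (u : E N → ℝ) :
    ∫ ξ, symbol m ‖ξ‖ * ‖fourierHat u ξ‖ ^ 2 = (2 * Real.pi) ^ N * form m u u := by
  rw [form_self, mul_inv_cancel_left₀ (by positivity)]

theorem MemH.integrable_symbol_mul (hN : 1 ≤ N) (hm : m ≠ 0) (hΩ : IsBoundedOpen Ω)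
    (hu : MemH m Ω u) : Integrable fun ξ : E N => symbol m ‖ξ‖ * ‖fourierHat u ξ‖ ^ 2 := by
  refine (hu.integrable_form hN hm hΩ hu).congr (.of_forall fun ξ => ?_)
  simp only
  rw [Complex.mul_conj, Complex.ofReal_re, Complex.normSq_eq_norm_sq, symbol]

/-- The lower bound for the quadratic form that comes from comparing the symbol with a constant
level `s` and from `|û|² ≤ |Ω| ‖u‖²`. -/
theorem MemH.le_form (hN : 1 ≤ N) (hm : m ≠ 0) (hΩ : IsBoundedOpen Ω) (hu : MemH m Ω u) (s : ℝ) :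
    (s - ((2 * Real.pi) ^ N)⁻¹ * (volume.real Ω * ∫ ξ : E N, levelGap m s ‖ξ‖)) * ∫ x, u x ^ 2 ≤
      form m u u := by
  obtain ⟨hPi, hP⟩ := hu.suppL2.integral_norm_sq_fourierHat hΩ
  have hgap := (integrable_levelGap (N := N) hN hm s).mul_const (volume.real Ω * ∫ x, u x ^ 2)
  have h : ∫ ξ, (s * ‖fourierHat u ξ‖ ^ 2 - levelGap m s ‖ξ‖ * (volume.real Ω * ∫ x, u x ^ 2)) ≤
      ∫ ξ, symbol m ‖ξ‖ * ‖fourierHat u ξ‖ ^ 2 := by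
    refine integral_mono ((hPi.const_mul s).sub hgap) (hu.integrable_symbol_mul hN hm hΩ) fun ξ => ?_
    have h1 : s - symbol m ‖ξ‖ ≤ levelGap m s ‖ξ‖ := le_max_left _ _
    have h2 := mul_le_mul_of_nonneg_left (hu.suppL2.norm_sq_fourierHat_le hΩ ξ)
      (levelGap_nonneg (m := m) s ‖ξ‖)
    have h3 := mul_le_mul_of_nonneg_right h1 (sq_nonneg ‖fourierHat u ξ‖)
    simp only
    linarith
  rw [integral_sub (hPi.const_mul s) hgap, integral_const_mul, integral_mul_const, hP,
    integral_symbol_mul] at h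
  have hpi : (0 : ℝ) < (2 * Real.pi) ^ N := by positivity
  refine le_of_mul_le_mul_left (le_of_eq_of_le ?_ h) hpi
  field_simp

/-- A Gårding inequality: `logWeight_le` integrated against `|û|²`, with the negative part of the
symbol absorbed by `|û|² ≤ |Ω| ‖u‖²`. -/
theorem exists_energy_le (hN : 1 ≤ N) (hm : m ≠ 0) (hΩ : IsBoundedOpen Ω) :
    ∃ C : ℝ, 0 ≤ C ∧ ∀ u, MemH m Ω u →
      energy m u ≤ (2 * Real.pi) ^ N * form m u u + C * ∫ x, u x ^ 2 := by
  refine ⟨2 ^ m * (2 * Real.pi) ^ N + volume.real Ω * ∫ ξ : E N, levelGap m 0 ‖ξ‖, ?_,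
    fun u hu => ?_⟩
  · have : 0 ≤ ∫ ξ : E N, levelGap m 0 ‖ξ‖ := integral_nonneg fun ξ => levelGap_nonneg _ _
    positivity
  obtain ⟨hPi, hP⟩ := hu.suppL2.integral_norm_sq_fourierHat hΩ
  have hgap := (integrable_levelGap (N := N) hN hm 0).mul_const (volume.real Ω * ∫ x, u x ^ 2)
  have hsym := hu.integrable_symbol_mul hN hm hΩ
  have h : energy m u ≤ ∫ ξ, (2 ^ m * ‖fourierHat u ξ‖ ^ 2 + symbol m ‖ξ‖ * ‖fourierHat u ξ‖ ^ 2 +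
      levelGap m 0 ‖ξ‖ * (volume.real Ω * ∫ x, u x ^ 2)) := by
    refine integral_mono (integrable_weighted (hu.suppL2.integrable hΩ) (hu.normSq_lt_top hΩ))
      (((hPi.const_mul _).add hsym).add hgap) fun ξ => ?_
    have h2 := mul_le_mul_of_nonneg_left (hu.suppL2.norm_sq_fourierHat_le hΩ ξ)
      (levelGap_nonneg (m := m) 0 ‖ξ‖)
    have h3 := mul_le_mul_of_nonneg_right (logWeight_le (m := m) (norm_nonneg ξ))
      (sq_nonneg ‖fourierHat u ξ‖)
    simp only
    linarith
  have h4 := integral_add ((hPi.const_mul (2 ^ m)).add hsym) hgap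
  simp only [Pi.add_apply] at h4
  rw [h4, integral_add (hPi.const_mul _) hsym, integral_const_mul, integral_mul_const, hP,
    integral_symbol_mul] at h
  refine h.trans_eq ?_
  ring

/-- The converse of the Gårding bound, from `abs_symbol_le`; it makes the form small on differences
that are small in `‖·‖_m` and in `L²`. -/
theorem exists_form_le (hN : 1 ≤ N) (hm : m ≠ 0) (hΩ : IsBoundedOpen Ω) :
    ∃ C : ℝ, 0 ≤ C ∧ ∀ u, MemH m Ω u → form m u u ≤ C * (energy m u + ∫ x, u x ^ 2) := by
  set A : ℝ := ∫ ξ : E N, (Iio (1 : ℝ)).indicator (fun r => |symbol m r|) ‖ξ‖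
  have hA : 0 ≤ A := integral_nonneg fun ξ => indicator_nonneg (fun _ _ => abs_nonneg _) _
  have hpi : (0 : ℝ) < (2 * Real.pi) ^ N := by positivity
  refine ⟨((2 * Real.pi) ^ N)⁻¹ * (2 ^ m + A * volume.real Ω), by positivity, fun u hu => ?_⟩
  have hw := integrable_weighted (hu.suppL2.integrable hΩ) (hu.normSq_lt_top hΩ)
  have hb := (integrable_indicator_symbol (N := N) (m := m) hN hm).mul_const
    (volume.real Ω * ∫ x, u x ^ 2)
  have h : ∫ ξ, symbol m ‖ξ‖ * ‖fourierHat u ξ‖ ^ 2 ≤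
      ∫ ξ : E N, (2 ^ m * (logWeight m ‖ξ‖ * ‖fourierHat u ξ‖ ^ 2) +
        (Iio (1 : ℝ)).indicator (fun r => |symbol m r|) ‖ξ‖ * (volume.real Ω * ∫ x, u x ^ 2)) := by
    refine integral_mono (hu.integrable_symbol_mul hN hm hΩ) ((hw.const_mul _).add hb) fun ξ => ?_
    have h1 : symbol m ‖ξ‖ ≤ |symbol m ‖ξ‖| := le_abs_self _
    have h2 := mul_le_mul_of_nonneg_right (h1.trans (abs_symbol_le (norm_nonneg ξ)))
      (sq_nonneg ‖fourierHat u ξ‖)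
    have h3 := mul_le_mul_of_nonneg_left (hu.suppL2.norm_sq_fourierHat_le hΩ ξ)
      (show 0 ≤ (Iio (1 : ℝ)).indicator (fun r => |symbol m r|) ‖ξ‖ from
        indicator_nonneg (fun _ _ => abs_nonneg _) _)
    simp only
    linarith
  rw [integral_add (hw.const_mul _) hb, integral_const_mul, integral_mul_const] at h
  rw [form_self, mul_assoc]
  refine mul_le_mul_of_nonneg_left (h.trans ?_) (by positivity)
  change 2 ^ m * energy m u + A * _ ≤ _
  have e1 : 0 ≤ energy m u := integral_nonneg fun ξ => weighted_nonneg _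
  have e2 : 0 ≤ ∫ x, u x ^ 2 := integral_nonneg fun x => sq_nonneg _
  have e3 : 0 ≤ A * volume.real Ω * energy m u := by positivity
  have e4 : 0 ≤ 2 ^ m * ∫ x, u x ^ 2 := by positivity
  linarith

end LogLap

/-! ### Compactness in `L²` -/

namespace LogLap

variable {N m : ℕ} {Ω : Set (E N)} {u v w : E N → ℝ}

/-- Splitting into real integrals lets weak convergence in the real space `L²` be tested against the
characters. -/
theorem fourierHat_eq_cos_sin (hu : Integrable u) (ξ : E N) :
    fourierHat u ξ = ((∫ x, u x * Real.cos (inner ℝ x ξ) : ℝ) : ℂ) -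
      Complex.I * ((∫ x, u x * Real.sin (inner ℝ x ξ) : ℝ) : ℂ) := by
  have hc : Integrable fun x => u x * Real.cos (inner ℝ x ξ) :=
    hu.mul_bdd (c := 1) (by fun_prop) (.of_forall fun _ => Real.abs_cos_le_one _)
  have hs : Integrable fun x => u x * Real.sin (inner ℝ x ξ) :=
    hu.mul_bdd (c := 1) (by fun_prop) (.of_forall fun _ => Real.abs_sin_le_one _)
  rw [← integral_complex_ofReal, ← integral_complex_ofReal, ← integral_const_mul,
    ← integral_sub hc.ofReal (hs.ofReal.const_mul _), fourierHat]
  congr 1; ext x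
  have : -(Complex.I * ((inner ℝ x ξ : ℝ) : ℂ)) = ((-(inner ℝ x ξ) : ℝ) : ℂ) * Complex.I := by
    push_cast; ring
  rw [this, Complex.exp_mul_I]
  push_cast
  rw [Complex.cos_neg, Complex.sin_neg]
  ring

theorem tendsto_logWeight_atTop (hm : m ≠ 0) : Tendsto (logWeight m) atTop atTop :=
  (tendsto_pow_atTop hm).comp
    (Real.tendsto_log_atTop.comp (tendsto_atTop_add_const_left _ _ tendsto_id))

/-- Bounded sequences of square integrable functions on `Ω` have a subsequence whose Fourier
transforms converge pointwise. -/
theorem exists_subseq_tendsto_fourierHat (hΩ : IsBoundedOpen Ω) {w : ℕ → E N → ℝ}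
    (hw : ∀ n, SuppL2 Ω (w n)) {B : ℝ} (hB : ∀ n, ∫ x, w n x ^ 2 ≤ B) :
    ∃ u, SuppL2 Ω u ∧ ∃ ns : ℕ → ℕ, StrictMono ns ∧
      ∀ ξ, Tendsto (fun k => fourierHat (w (ns k)) ξ) atTop (𝓝 (fourierHat u ξ)) := by
  have hΩm := hΩ.1.measurableSet
  let f : ℕ → Lp ℝ 2 (volume : Measure (E N)) := fun n => (hw n).memLp.toLp
  have hf : ∀ n, ‖f n‖ ≤ √B := fun n => by
    refine Real.le_sqrt_of_sq_le ((le_of_eq ?_).trans (hB n))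
    rw [← real_inner_self_eq_norm_sq, L2.inner_def]
    refine integral_congr_ae ?_
    filter_upwards [(hw n).memLp.coeFn_toLp] with x hx
    simp only [f]
    rw [hx]
    simp [sq]
  have : Fact ((2 : ENNReal) ≠ ⊤) := ⟨by norm_num⟩
  -- Sequential Banach-Alaoglu in the dual of `L²`; the Riesz isometry turns the limit functional
  -- back into a function.
  obtain ⟨ℓ, -, ns, hns, hlim⟩ := WeakDual.isSeqCompact_closedBall ℝ
    (Lp ℝ 2 (volume : Measure (E N))) 0 (√B)
    (x := fun n => StrongDual.toWeakDual (InnerProductSpace.toDual ℝ _ (f n)))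
    (fun n => by simpa using hf n)
  let u₀ := (InnerProductSpace.toDual ℝ (Lp ℝ 2 (volume : Measure (E N)))).symm
    (WeakDual.toStrongDual ℓ)
  have hu₀ : InnerProductSpace.toDual ℝ _ u₀ = WeakDual.toStrongDual ℓ :=
    (InnerProductSpace.toDual ℝ (Lp ℝ 2 (volume : Measure (E N)))).apply_symm_apply _
  have hlim' : ∀ g, Tendsto (fun k => (inner ℝ (f (ns k)) g : ℝ)) atTop (𝓝 (inner ℝ u₀ g)) := by
    intro g
    have h1 : inner ℝ u₀ g = ℓ g := by
      rw [← InnerProductSpace.toDual_apply_apply, hu₀, WeakDual.toStrongDual_apply]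
    rw [h1]
    exact ((WeakDual.eval_continuous g).tendsto ℓ).comp hlim
  have hu : SuppL2 Ω (Ω.indicator u₀) :=
    ⟨(Lp.memLp u₀).indicator hΩm, .of_forall fun x hx => by simp [hx]⟩
  -- A bounded continuous function such as a character need not be in `L²(ℝ^N)`, but its truncation
  -- to `Ω` is, and the truncation changes no integral against `w`.
  have hkey : ∀ h : E N → ℝ, Continuous h → (∀ x, |h x| ≤ 1) →
      Tendsto (fun k => ∫ x, w (ns k) x * h x) atTop (𝓝 (∫ x, Ω.indicator u₀ x * h x)) := by
    intro h hc hb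
    have hg : MemLp (Ω.indicator h) 2 (volume : Measure (E N)) := by
      refine (memLp_indicator_iff_restrict hΩm).2 ?_
      have : IsFiniteMeasure (volume.restrict Ω) := ⟨by simpa using hΩ.volume_lt_top⟩
      exact MemLp.of_bound hc.aestronglyMeasurable 1 (.of_forall hb)
    have h1 : ∀ k, (inner ℝ (f (ns k)) (hg.toLp _) : ℝ) = ∫ x, w (ns k) x * h x := fun k => by
      rw [L2.inner_def]
      refine integral_congr_ae ?_
      filter_upwards [(hw (ns k)).memLp.coeFn_toLp, hg.coeFn_toLp, (hw (ns k)).zero_off] with x h1 h2 h3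
      simp only [f]
      rw [h1, h2]
      by_cases hx : x ∈ Ω
      · simp [hx, mul_comm]
      · simp [hx, h3 hx]
    have h2 : (inner ℝ u₀ (hg.toLp _) : ℝ) = ∫ x, Ω.indicator u₀ x * h x := by
      rw [L2.inner_def]
      refine integral_congr_ae ?_
      filter_upwards [hg.coeFn_toLp] with x h2
      rw [h2]
      by_cases hx : x ∈ Ω
      · simp [hx, mul_comm]
      · simp [hx]
    have h3 := hlim' (hg.toLp _)
    simp only [h1, h2] at h3
    exact h3
  refine ⟨_, hu, ns, hns, fun ξ => ?_⟩
  rw [fourierHat_eq_cos_sin (hu.integrable hΩ)]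
  simp only [fourierHat_eq_cos_sin ((hw _).integrable hΩ)]
  have hc := hkey (fun x => Real.cos (inner ℝ x ξ)) (by fun_prop) fun x => Real.abs_cos_le_one _
  have hs := hkey (fun x => Real.sin (inner ℝ x ξ)) (by fun_prop) fun x => Real.abs_sin_le_one _
  exact ((Complex.continuous_ofReal.tendsto _).comp hc).sub
    (((Complex.continuous_ofReal.tendsto _).comp hs).const_mul _)

theorem energy_nonneg (u : E N → ℝ) : 0 ≤ energy m u := integral_nonneg fun _ => weighted_nonneg _

theorem energy_le_of_normSq_le (hu : Integrable u) {M : ℝ} (hM : 0 ≤ M)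
    (h : normSq m u ≤ ENNReal.ofReal M) : energy m u ≤ M := by
  rw [normSq_eq_ofReal hu (h.trans_lt ENNReal.ofReal_lt_top), ENNReal.ofReal_le_ofReal_iff hM] at h
  exact h

theorem SuppL2.integral_sub_sq_le (hu : SuppL2 Ω u) (hv : SuppL2 Ω v) :
    ∫ x, (u x - v x) ^ 2 ≤ 2 * (∫ x, u x ^ 2) + 2 * ∫ x, v x ^ 2 := by
  rw [← integral_const_mul, ← integral_const_mul,
    ← integral_add (hu.integrable_sq.const_mul 2) (hv.integrable_sq.const_mul 2)]
  refine integral_mono (hu.sub hv).integrable_sq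
    ((hu.integrable_sq.const_mul 2).add (hv.integrable_sq.const_mul 2)) fun x => ?_
  simp only
  nlinarith [sq_nonneg (u x + v x)]

/-- The compact embedding of `H_{m,0}(Ω)` into `L²`. -/
theorem exists_subseq_tendsto_L2 (hm : m ≠ 0) (hΩ : IsBoundedOpen Ω) {w : ℕ → E N → ℝ}
    (hw : ∀ n, SuppL2 Ω (w n)) {B : ℝ} (hB : ∀ n, ∫ x, w n x ^ 2 ≤ B) {M : ℝ} (hM0 : 0 ≤ M)
    (hM : ∀ n, normSq m (w n) ≤ ENNReal.ofReal M) :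
    ∃ u, SuppL2 Ω u ∧ ∃ ns : ℕ → ℕ, StrictMono ns ∧
      (∀ ξ, Tendsto (fun k => fourierHat (w (ns k)) ξ) atTop (𝓝 (fourierHat u ξ))) ∧
      Tendsto (fun k => ∫ x, (u x - w (ns k) x) ^ 2) atTop (𝓝 0) := by
  obtain ⟨u, hu, ns, hns, hlim⟩ := exists_subseq_tendsto_fourierHat hΩ hw hB
  refine ⟨u, hu, ns, hns, hlim, ?_⟩
  have hwi := fun n => (hw n).integrable hΩ
  have hui := hu.integrable hΩ
  have huM : normSq m u ≤ ENNReal.ofReal M :=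
    normSq_le_of_tendsto (fun k => hwi (ns k)) hlim (.of_forall fun k => hM (ns k))
      tendsto_const_nhds
  set d : ℕ → E N → ℝ := fun k x => u x - w (ns k) x with hd_def
  have hd : ∀ k, SuppL2 Ω (d k) := fun k => hu.sub (hw (ns k))
  have hdM : ∀ k, normSq m (d k) ≤ ENNReal.ofReal (4 * M) := fun k => by
    refine (normSq_sub_le hui (hwi (ns k))).trans ?_
    calc 2 * normSq m u + 2 * normSq m (w (ns k))
        ≤ 2 * ENNReal.ofReal M + 2 * ENNReal.ofReal M := by gcongr; exact hM _
      _ = ENNReal.ofReal (4 * M) := by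
        rw [ENNReal.ofReal_mul (by norm_num), ← add_mul]; norm_num
  have hdE : ∀ k, energy m (d k) ≤ 4 * M := fun k =>
    energy_le_of_normSq_le ((hd k).integrable hΩ) (by positivity) (hdM k)
  have hpi : (0 : ℝ) < (2 * Real.pi) ^ N := by positivity
  have hB0 : 0 ≤ B := (integral_nonneg fun x => sq_nonneg _).trans (hB 0)
  have hu0 : 0 ≤ ∫ x, u x ^ 2 := integral_nonneg fun x => sq_nonneg _
  have hdB : ∀ k, ∫ x, d k x ^ 2 ≤ 2 * (∫ x, u x ^ 2) + 2 * B := fun k =>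
    (hu.integral_sub_sq_le (hw (ns k))).trans (by linarith [hB (ns k)])
  -- Low frequencies: the transforms converge pointwise under a constant majorant, so dominated
  -- convergence applies on each ball.
  have hball : ∀ R : ℝ, Tendsto (fun k => ∫ ξ in Metric.ball (0 : E N) R, ‖fourierHat (d k) ξ‖ ^ 2)
      atTop (𝓝 0) := by
    intro R
    have h0 : (0 : ℝ) = ∫ ξ in Metric.ball (0 : E N) R, (0 : ℝ) := by simp
    rw [h0]
    refine tendsto_integral_of_dominated_convergence
      (fun _ => volume.real Ω * (2 * (∫ x, u x ^ 2) + 2 * B)) (fun k => ?_) ?_ (fun k => ?_) ?_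
    · exact ((continuous_fourierHat ((hd k).integrable hΩ)).norm.pow 2).aestronglyMeasurable
    · exact integrableOn_const measure_ball_lt_top.ne
    · refine .of_forall fun ξ => ?_
      rw [Real.norm_of_nonneg (by positivity)]
      exact ((hd k).norm_sq_fourierHat_le hΩ ξ).trans
        (mul_le_mul_of_nonneg_left (hdB k) measureReal_nonneg)
    · refine .of_forall fun ξ => ?_
      have h1 : Tendsto (fun k => fourierHat u ξ - fourierHat (w (ns k)) ξ) atTop (𝓝 0) := by
        simpa using (hlim ξ).const_sub (fourierHat u ξ)
      have h2 := h1.norm.pow 2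
      simp only [norm_zero, ne_eq, OfNat.ofNat_ne_zero, not_false_eq_true, zero_pow] at h2
      refine h2.congr fun k => ?_
      rw [hd_def]
      simp only
      rw [fourierHat_sub hui (hwi (ns k))]
  -- High frequencies: outside the ball the weight is at least `logWeight m R`, so the tail is at
  -- most the energy divided by that number, uniformly in `k`.
  have htail : ∀ R : ℝ, 0 ≤ R → ∀ k, (2 * Real.pi) ^ N * ∫ x, d k x ^ 2 ≤
      (∫ ξ in Metric.ball (0 : E N) R, ‖fourierHat (d k) ξ‖ ^ 2) + (logWeight m R)⁻¹ * (4 * M) := by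
    intro R hR k
    obtain ⟨hPi, hP⟩ := (hd k).integral_norm_sq_fourierHat hΩ
    have hW : 0 < logWeight m R := zero_lt_one.trans_le (one_le_logWeight hR)
    have hE := integrable_weighted ((hd k).integrable hΩ) ((hdM k).trans_lt ENNReal.ofReal_lt_top)
    rw [← hP, ← integral_indicator measurableSet_ball]
    have h1 : ∫ ξ, ‖fourierHat (d k) ξ‖ ^ 2 ≤
        ∫ ξ, ((Metric.ball (0 : E N) R).indicator (fun ξ => ‖fourierHat (d k) ξ‖ ^ 2) ξ +
          (logWeight m R)⁻¹ * (logWeight m ‖ξ‖ * ‖fourierHat (d k) ξ‖ ^ 2)) := by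
      refine integral_mono hPi ((hPi.indicator measurableSet_ball).add (hE.const_mul _)) fun ξ => ?_
      simp only
      by_cases hξ : ξ ∈ Metric.ball (0 : E N) R
      · rw [indicator_of_mem hξ]
        have := @weighted_nonneg N m (d k) ξ
        have := mul_nonneg (inv_pos.2 hW).le this
        linarith
      · rw [indicator_of_notMem hξ, zero_add, ← mul_assoc]
        refine le_mul_of_one_le_left (by positivity) ?_
        rw [← div_eq_inv_mul, one_le_div hW]
        exact logWeight_mono hR (by simpa using hξ)
    rw [integral_add (hPi.indicator measurableSet_ball) (hE.const_mul _), integral_const_mul] at h1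
    refine h1.trans ?_
    gcongr
    exact hdE k
  have hfin : Tendsto (fun k => (2 * Real.pi) ^ N * ∫ x, d k x ^ 2) atTop (𝓝 0) := by
    refine tendsto_order.2 ⟨fun a ha => .of_forall fun k => ha.trans_le ?_, fun ε hε => ?_⟩
    · exact mul_nonneg hpi.le (integral_nonneg fun x => sq_nonneg _)
    · have h1 : Tendsto (fun R => (logWeight m R)⁻¹ * (4 * M)) atTop (𝓝 0) := by
        simpa using (tendsto_logWeight_atTop hm).inv_tendsto_atTop.mul_const (4 * M)
      obtain ⟨R, hR, hR0⟩ := ((h1.eventually (gt_mem_nhds (half_pos hε))).and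
        (eventually_ge_atTop 0)).exists
      filter_upwards [(hball R).eventually (gt_mem_nhds (half_pos hε))] with k hk
      linarith [htail R hR0 k]
  have := hfin.const_mul ((2 * Real.pi) ^ N)⁻¹
  simpa only [mul_zero, inv_mul_cancel_left₀ hpi.ne'] using this

/-! ### Minimising the Rayleigh quotient -/

section quadratic

theorem MemH.add_smul (hΩ : IsBoundedOpen Ω) (hu : MemH m Ω u) (hv : MemH m Ω v) (c : ℝ) :
    MemH m Ω fun x => u x + c * v x := hu.add hΩ (hv.smul c)

theorem form_add_smul_self (hN : 1 ≤ N) (hm : m ≠ 0) (hΩ : IsBoundedOpen Ω) (hu : MemH m Ω u)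
    (hv : MemH m Ω v) (c : ℝ) :
    form m (fun x => u x + c * v x) (fun x => u x + c * v x) =
      form m u u + 2 * c * form m u v + c ^ 2 * form m v v := by
  have hw := hu.add_smul hΩ hv c
  rw [form_add_left hN hm hΩ hu (hv.smul c) hw, form_smul_left, form_comm u, form_comm v,
    form_add_left hN hm hΩ hu (hv.smul c) hu, form_add_left hN hm hΩ hu (hv.smul c) hv,
    form_smul_left, form_smul_left, form_comm v u]
  ring

theorem SuppL2.integral_add_smul_sq (hu : SuppL2 Ω u) (hv : SuppL2 Ω v) (c : ℝ) :
    ∫ x, (u x + c * v x) ^ 2 =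
      (∫ x, u x ^ 2) + 2 * c * (∫ x, u x * v x) + c ^ 2 * ∫ x, v x ^ 2 := by
  have h1 : (fun x => (u x + c * v x) ^ 2) =
      fun x => (u x ^ 2 + 2 * c * (u x * v x)) + c ^ 2 * v x ^ 2 := by ext x; ring
  have h2 := hu.integrable_sq
  have h3 := (hu.integrable_mul hv).const_mul (2 * c)
  have h4 := integral_add (h2.add h3) (hv.integrable_sq.const_mul (c ^ 2))
  simp only [Pi.add_apply] at h4
  rw [h1, h4, integral_add h2 h3, integral_const_mul, integral_const_mul]

/-- With zero constant term the discriminant is `4β²`, and it must be nonpositive. -/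
theorem eq_zero_of_forall_quadratic_nonneg {β γ : ℝ} (h : ∀ c : ℝ, 0 ≤ 2 * c * β + c ^ 2 * γ) :
    β = 0 := by
  have := discrim_le_zero (a := γ) (b := 2 * β) (c := 0) fun c => by linarith [h c]
  rw [discrim] at this
  nlinarith [sq_nonneg β]

/-- A minimiser of the Rayleigh quotient is an eigenfunction. -/
theorem isEigenvalue_of_minimizer (hN : 1 ≤ N) (hm : m ≠ 0) (hΩ : IsBoundedOpen Ω)
    {lam : ℝ} (hmin : ∀ v, MemH m Ω v → lam * ∫ x, v x ^ 2 ≤ form m v v) (hu : MemH m Ω u)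
    (hu0 : 0 < ∫ x, u x ^ 2) (hQ : form m u u ≤ lam * ∫ x, u x ^ 2) : IsEigenvalue m Ω lam := by
  refine ⟨u, hu, fun h0 => ?_, fun v hv => ?_⟩
  · refine hu0.ne' ?_
    rw [integral_congr_ae (g := fun _ => 0) (by filter_upwards [h0] with x hx; simp [hx])]
    simp
  · rw [hu.suppL2.setIntegral_mul hΩ]
    refine sub_eq_zero.1 (eq_zero_of_forall_quadratic_nonneg
      (γ := form m v v - lam * ∫ x, v x ^ 2) fun c => ?_)
    have h1 := hmin _ (hu.add_smul hΩ hv c)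
    rw [form_add_smul_self hN hm hΩ hu hv, hu.suppL2.integral_add_smul_sq hv.suppL2] at h1
    linarith

/-- The parallelogram inequality for the non-negative form `(u, u)_m - λ ‖u‖²`. -/
theorem form_sub_self_le (hN : 1 ≤ N) (hm : m ≠ 0) (hΩ : IsBoundedOpen Ω)
    {lam : ℝ} (hmin : ∀ v, MemH m Ω v → lam * ∫ x, v x ^ 2 ≤ form m v v) (hu : MemH m Ω u)
    (hv : MemH m Ω v) :
    form m (fun x => u x - v x) (fun x => u x - v x) - lam * ∫ x, (u x - v x) ^ 2 ≤
      2 * (form m u u - lam * ∫ x, u x ^ 2) + 2 * (form m v v - lam * ∫ x, v x ^ 2) := by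
  have h1 := hmin _ (hu.add_smul hΩ hv 1)
  have h2 := form_add_smul_self hN hm hΩ hu hv (-1)
  have h3 := hu.suppL2.integral_add_smul_sq hv.suppL2 (-1)
  rw [form_add_smul_self hN hm hΩ hu hv, hu.suppL2.integral_add_smul_sq hv.suppL2] at h1
  simp only [neg_one_mul, ← sub_eq_add_neg] at h2 h3
  rw [h2, h3]
  linarith

/-- The Rayleigh quotient attains its infimum. -/
theorem exists_minimizer (hN : 1 ≤ N) (hm : m ≠ 0) (hΩ : IsBoundedOpen Ω) :
    ∃ lam : ℝ, (∀ v, MemH m Ω v → lam * ∫ x, v x ^ 2 ≤ form m v v) ∧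
      ∃ u, MemH m Ω u ∧ 0 < ∫ x, u x ^ 2 ∧ form m u u ≤ lam * ∫ x, u x ^ 2 := by
  have hpi : (0 : ℝ) < (2 * Real.pi) ^ N := by positivity
  set S : Set ℝ := {t | ∃ u, MemH m Ω u ∧ ∫ x, u x ^ 2 = 1 ∧ form m u u = t} with hS
  have hSne : S.Nonempty := by
    obtain ⟨u, hu, h1⟩ := exists_memH_integral_sq_eq_one (m := m) hΩ
    exact ⟨_, u, hu, h1, rfl⟩
  have hSb : BddBelow S := by
    refine ⟨0 - ((2 * Real.pi) ^ N)⁻¹ * (volume.real Ω * ∫ ξ : E N, levelGap m 0 ‖ξ‖), ?_⟩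
    rintro _ ⟨u, hu, h1, rfl⟩
    have := hu.le_form hN hm hΩ 0
    rw [h1, mul_one] at this
    exact this
  set lam := sInf S with hlam
  have hmin : ∀ v, MemH m Ω v → lam * ∫ x, v x ^ 2 ≤ form m v v := by
    intro v hv
    have hv0 : 0 ≤ ∫ x, v x ^ 2 := integral_nonneg fun x => sq_nonneg _
    rcases hv0.eq_or_lt with h0 | h0
    -- If `v` has zero `L²` norm it cannot be normalised; the level bound then reads `0 ≤ form m v
    -- v`.
    · have := hv.le_form hN hm hΩ 0
      rw [← h0, mul_zero] at this ⊢
      exact this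
    · have h1 : (√(∫ x, v x ^ 2))⁻¹ ^ 2 = (∫ x, v x ^ 2)⁻¹ := by
        rw [inv_pow, Real.sq_sqrt hv0]
      have h2 : lam ≤ (∫ x, v x ^ 2)⁻¹ * form m v v := by
        refine csInf_le hSb ⟨fun x => (√(∫ x, v x ^ 2))⁻¹ * v x, hv.smul _, ?_, ?_⟩
        · simp only [mul_pow]
          rw [integral_const_mul, h1, inv_mul_cancel₀ h0.ne']
        · rw [form_smul_left, form_comm, form_smul_left, ← h1]
          ring
      rwa [← div_eq_inv_mul, le_div_iff₀ h0] at h2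
  refine ⟨lam, hmin, ?_⟩
  obtain ⟨t, -, htlim, htS⟩ := exists_seq_tendsto_sInf hSne hSb
  choose w hw hw1 hwt using htS
  obtain ⟨C, hC0, hC⟩ := exists_energy_le (m := m) hN hm hΩ
  obtain ⟨C', hC0', hC'⟩ := exists_form_le (m := m) hN hm hΩ
  obtain ⟨b, hb⟩ := htlim.bddAbove_range
  have hen : ∀ n, energy m (w n) ≤ (2 * Real.pi) ^ N * b + C := fun n => by
    have h1 := hC _ (hw n)
    have h2 := mul_le_mul_of_nonneg_left (hb (mem_range_self n)) hpi.le
    rw [hw1, mul_one, hwt] at h1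
    linarith
  have hofReal : ∀ v, MemH m Ω v → normSq m v = ENNReal.ofReal (energy m v) := fun v hv =>
    normSq_eq_ofReal (hv.suppL2.integrable hΩ) (hv.normSq_lt_top hΩ)
  obtain ⟨u, hu, ns, hns, hhat, hL2⟩ := exists_subseq_tendsto_L2 hm hΩ (fun n => (hw n).suppL2)
    (fun n => (hw1 n).le) ((energy_nonneg _).trans (hen 0)) fun n => by
      rw [hofReal _ (hw n)]; exact ENNReal.ofReal_le_ofReal (hen n)
  have hui := hu.integrable hΩ
  have htns : Tendsto (fun k => t (ns k) - lam) atTop (𝓝 0) := by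
    have := (htlim.comp hns.tendsto_atTop).sub_const lam
    rwa [← hlam, sub_self] at this
  set P : ℝ := (2 * Real.pi) ^ N
  set K : ℝ := P * |lam| + C
  have hK : 0 ≤ K := by positivity
  set δ : ℕ → ℝ := fun k => ∫ x, (u x - w (ns k) x) ^ 2 with hδ
  have hδ0 : ∀ k, 0 ≤ δ k := fun k => integral_nonneg fun x => sq_nonneg _
  -- The sequence is Cauchy in energy: the Gårding bound reduces this to the form of a difference,
  -- which the parallelogram inequality bounds by the excesses `t - lam` and `L²` distances.
  have hpair : ∀ j k, energy m (fun x => w (ns j) x - w (ns k) x) ≤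
      P * (2 * (t (ns j) - lam) + 2 * (t (ns k) - lam)) + K * (2 * δ j + 2 * δ k) := by
    intro j k
    have h1 := hC _ ((hw (ns j)).sub hΩ (hw (ns k)))
    have h2 := form_sub_self_le hN hm hΩ hmin (hw (ns j)) (hw (ns k))
    rw [hw1, hw1, hwt, hwt, mul_one] at h2
    have h3 : ∫ x, (w (ns j) x - w (ns k) x) ^ 2 ≤ 2 * δ j + 2 * δ k := by
      have := (hu.sub (hw (ns k)).suppL2).integral_sub_sq_le (hu.sub (hw (ns j)).suppL2)
      simp only [sub_sub_sub_cancel_left] at this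
      linarith
    have h4 : 0 ≤ ∫ x, (w (ns j) x - w (ns k) x) ^ 2 := integral_nonneg fun x => sq_nonneg _
    have h5 : form m (fun x => w (ns j) x - w (ns k) x) (fun x => w (ns j) x - w (ns k) x) ≤
        2 * (t (ns j) - lam) + 2 * (t (ns k) - lam) +
          |lam| * ∫ x, (w (ns j) x - w (ns k) x) ^ 2 := by
      have := mul_le_mul_of_nonneg_right (le_abs_self lam) h4
      linarith
    have h6 := mul_le_mul_of_nonneg_left h5 hpi.le
    have h7 := mul_le_mul_of_nonneg_left h3 hK
    calc _ ≤ _ := h1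
      _ ≤ P * (2 * (t (ns j) - lam) + 2 * (t (ns k) - lam)) +
          K * ∫ x, (w (ns j) x - w (ns k) x) ^ 2 := by simp only [K]; linarith
      _ ≤ _ := by linarith
  -- Fatou's lemma as `j → ∞` in `hpair` turns the Cauchy property into convergence to `u`.
  have hlimit : ∀ k, normSq m (fun x => u x - w (ns k) x) ≤
      ENNReal.ofReal (P * (2 * (t (ns k) - lam)) + K * (2 * δ k)) := by
    intro k
    refine normSq_le_of_tendsto (w := fun j x => w (ns j) x - w (ns k) x)
      (b := fun j => ENNReal.ofReal (P * (2 * (t (ns j) - lam) + 2 * (t (ns k) - lam)) +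
        K * (2 * δ j + 2 * δ k)))
      (fun j => ((hw (ns j)).sub hΩ (hw (ns k))).suppL2.integrable hΩ) (fun ξ => ?_)
      (.of_forall fun j => ?_) (ENNReal.tendsto_ofReal ?_)
    · rw [fourierHat_sub hui ((hw (ns k)).suppL2.integrable hΩ)]
      refine ((hhat ξ).sub_const _).congr fun j => ?_
      rw [fourierHat_sub ((hw (ns j)).suppL2.integrable hΩ) ((hw (ns k)).suppL2.integrable hΩ)]
    · rw [hofReal _ ((hw (ns j)).sub hΩ (hw (ns k)))]
      exact ENNReal.ofReal_le_ofReal (hpair j k)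
    · have h1 := ((htns.const_mul 2).add_const (2 * (t (ns k) - lam))).const_mul P
      have h2 := ((hL2.const_mul 2).add_const (2 * δ k)).const_mul K
      simpa using h1.add h2
  have hbound0 : Tendsto (fun k => P * (2 * (t (ns k) - lam)) + K * (2 * δ k)) atTop (𝓝 0) := by
    simpa using ((htns.const_mul 2).const_mul P).add ((hL2.const_mul 2).const_mul K)
  have hconv : Tendsto (fun k => normSq m (fun x => u x - w (ns k) x)) atTop (𝓝 0) := by
    refine tendsto_of_tendsto_of_tendsto_of_le_of_le tendsto_const_nhds ?_ (fun _ => zero_le) hlimit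
    simpa using ENNReal.tendsto_ofReal hbound0
  have huH : MemH m Ω u := MemH.of_tendsto hΩ hu (fun k => hw (ns k)) hconv
  have ht0 : ∀ k, 0 ≤ t (ns k) - lam := fun k => by
    have := hmin _ (hw (ns k))
    rw [hw1, hwt, mul_one] at this
    linarith
  refine ⟨u, huH, ?_, ?_⟩
  -- Since `1 = ‖w‖² ≤ 2 ‖u‖² + 2 ‖u - w‖²`, squared distance below `1/4` forces `u ≠ 0`.
  · obtain ⟨k, hk⟩ := (hL2.eventually (gt_mem_nhds (show (0 : ℝ) < 1 / 4 by norm_num))).exists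
    have h1 := hu.integral_sub_sq_le (hu.sub (hw (ns k)).suppL2)
    simp only [sub_sub_cancel] at h1
    rw [hw1] at h1
    linarith
  -- Writing `u = w - (-(u - w))`, the parallelogram inequality bounds the excess of `u` by those of
  -- `w` and of `u - w`, both of which tend to zero.
  · have hQ : ∀ k, form m u u - lam * ∫ x, u x ^ 2 ≤ 2 * (t (ns k) - lam) +
        2 * (C' * ((P * (2 * (t (ns k) - lam)) + K * (2 * δ k)) + δ k) + |lam| * δ k) := by
      intro k
      have hd := huH.sub hΩ (hw (ns k))
      have h1 := form_sub_self_le hN hm hΩ hmin (hw (ns k)) (hd.smul (-1))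
      have e1 : ∀ x, w (ns k) x - -1 * (u x - w (ns k) x) = u x := fun x => by ring
      simp only [e1] at h1
      have e2 : ∀ x, (-1 * (u x - w (ns k) x)) ^ 2 = (u x - w (ns k) x) ^ 2 := fun x => by ring
      rw [hw1, hwt, form_smul_left,
        form_comm (fun x => u x - w (ns k) x) (fun x => -1 * (u x - w (ns k) x)),
        form_smul_left] at h1
      simp only [e2] at h1
      have h2 := hC' _ hd
      have h3 : energy m (fun x => u x - w (ns k) x) ≤
          P * (2 * (t (ns k) - lam)) + K * (2 * δ k) := by
        refine energy_le_of_normSq_le (hd.suppL2.integrable hΩ) ?_ (hlimit k)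
        have := ht0 k
        have := hδ0 k
        positivity
      have h4 := mul_le_mul_of_nonneg_left h3 hC0'
      have h5 := mul_le_mul_of_nonneg_right (neg_abs_le lam) (hδ0 k)
      change form m (fun x => u x - w (ns k) x) (fun x => u x - w (ns k) x) ≤
        C' * (energy m (fun x => u x - w (ns k) x) + δ k) at h2
      change form m u u - lam * ∫ x, u x ^ 2 ≤ 2 * (t (ns k) - lam * 1) +
        2 * (-1 * (-1 * form m (fun x => u x - w (ns k) x) (fun x => u x - w (ns k) x)) -
          lam * δ k) at h1
      linarith
    have hlimQ : Tendsto (fun k => 2 * (t (ns k) - lam) +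
        2 * (C' * ((P * (2 * (t (ns k) - lam)) + K * (2 * δ k)) + δ k) + |lam| * δ k)) atTop
        (𝓝 0) := by
      simpa using (htns.const_mul 2).add
        ((((hbound0.add hL2).const_mul C').add (hL2.const_mul |lam|)).const_mul 2)
    have := ge_of_tendsto' hlimQ hQ
    linarith

end quadratic

/-- Testing the eigenvalue equation with the eigenfunction itself shows that the eigenvalue is a
value of the Rayleigh quotient. -/
theorem IsEigenvalue.ge_of_forall_le_form (hΩ : IsBoundedOpen Ω) {c lam : ℝ}
    (hc : ∀ v, MemH m Ω v → c * ∫ x, v x ^ 2 ≤ form m v v) (h : IsEigenvalue m Ω lam) :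
    c ≤ lam := by
  obtain ⟨φ, hφ, hne, heq⟩ := h
  have h1 := heq φ hφ
  rw [hφ.suppL2.setIntegral_mul hΩ] at h1
  simp only [← sq] at h1
  have h2 : 0 ≤ ∫ x, φ x ^ 2 := integral_nonneg fun x => sq_nonneg _
  have h3 : ∫ x, φ x ^ 2 ≠ 0 := fun h0 => hne <| by
    have := (integral_eq_zero_iff_of_nonneg (fun x => sq_nonneg (φ x))
      hφ.suppL2.integrable_sq).1 h0
    filter_upwards [this] with x hx
    simpa using hx
  refine le_of_mul_le_mul_right ?_ (h2.lt_of_ne h3.symm)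
  rw [← h1]
  exact hc φ hφ

/-- The first eigenvalue is attained. -/
theorem isLeast_firstEigenvalue (hN : 1 ≤ N) (hm : m ≠ 0) (hΩ : IsBoundedOpen Ω) :
    IsLeast {μ : ℝ | IsEigenvalue m Ω μ} (firstEigenvalue m Ω) := by
  obtain ⟨lam, hmin, u, hu, hu0, hQ⟩ := exists_minimizer hN hm hΩ
  have h : IsLeast {μ : ℝ | IsEigenvalue m Ω μ} lam :=
    ⟨isEigenvalue_of_minimizer hN hm hΩ hmin hu hu0 hQ,
      fun μ hμ => IsEigenvalue.ge_of_forall_le_form hΩ hmin hμ⟩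
  rwa [firstEigenvalue, h.csInf_eq]

/-- The lower bound for the first eigenvalue given by a level `s`. -/
theorem le_firstEigenvalue (hN : 1 ≤ N) (hm : m ≠ 0) (hΩ : IsBoundedOpen Ω) (s : ℝ) :
    s - ((2 * Real.pi) ^ N)⁻¹ * (volume.real Ω * ∫ ξ : E N, levelGap m s ‖ξ‖) ≤
      firstEigenvalue m Ω :=
  IsEigenvalue.ge_of_forall_le_form hΩ (fun _ hv => hv.le_form hN hm hΩ s)
    (isLeast_firstEigenvalue hN hm hΩ).1

end LogLap

/-! ### The gap integral for odd `m` -/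

namespace LogLap

variable {N m : ℕ}

theorem integral_Iic_pow_mul_exp (n : ℕ) :
    IntegrableOn (fun t : ℝ => (-t) ^ n * Real.exp t) (Iic 0) ∧
      ∫ t in Iic (0 : ℝ), (-t) ^ n * Real.exp t = n.factorial := by
  have hpos : (0 : ℝ) < n + 1 := by positivity
  have hcongr : EqOn (fun x : ℝ => Real.exp (-x) * x ^ ((n : ℝ) + 1 - 1))
      (fun x : ℝ => x ^ n * Real.exp (-x)) (Ioi 0) := fun x _ => by
    simp only [add_sub_cancel_right, Real.rpow_natCast]; ring
  have h1 := (integrableOn_congr_fun hcongr measurableSet_Ioi).1 (Real.GammaIntegral_convergent hpos)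
  have h2 := Real.Gamma_eq_integral hpos
  rw [setIntegral_congr_fun measurableSet_Ioi hcongr, Real.Gamma_nat_eq_factorial] at h2
  constructor
  · have h3 : IntegrableOn (fun x : ℝ => x ^ n * Real.exp (-x)) (Ici (-0)) := by
      rw [neg_zero, integrableOn_Ici_iff_integrableOn_Ioi]; exact h1
    simpa using h3.comp_neg_Iic
  · have h3 := integral_comp_neg_Iic 0 (fun x : ℝ => x ^ n * Real.exp (-x))
    simp only [neg_neg, neg_zero] at h3
    rw [h3, h2]

theorem integral_pow_succ_mul_exp (n : ℕ) (κ : ℝ) :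
    ∫ t in (0 : ℝ)..κ, t ^ (n + 1) * Real.exp t =
      κ ^ (n + 1) * Real.exp κ - (n + 1) * ∫ t in (0 : ℝ)..κ, t ^ n * Real.exp t := by
  have h := intervalIntegral.integral_mul_deriv_eq_deriv_mul (a := 0) (b := κ)
    (u := fun t : ℝ => t ^ (n + 1)) (v := Real.exp) (u' := fun t => ((n + 1 : ℕ) : ℝ) * t ^ n)
    (v' := Real.exp) (fun t _ => by simpa using hasDerivAt_pow (n + 1) t)
    (fun t _ => Real.hasDerivAt_exp t) (Continuous.intervalIntegrable (by fun_prop) _ _)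
    (Continuous.intervalIntegrable (by fun_prop) _ _)
  rw [h, ← intervalIntegral.integral_const_mul]
  simp [mul_assoc]

/-- Dropping `e^t ≥ 1` leaves `κ^{n+1}/(n+1) ≥ κ^n ≥ n^n ≥ n!`. -/
theorem factorial_le_integral_pow_mul_exp (n : ℕ) {κ : ℝ} (hκ : (n : ℝ) + 1 ≤ κ) :
    (n.factorial : ℝ) ≤ ∫ t in (0 : ℝ)..κ, t ^ n * Real.exp t := by
  have hκ0 : 0 ≤ κ := by linarith [n.cast_nonneg (α := ℝ)]
  have h1 : ∫ t in (0 : ℝ)..κ, t ^ n ≤ ∫ t in (0 : ℝ)..κ, t ^ n * Real.exp t := by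
    refine intervalIntegral.integral_mono_on hκ0 (Continuous.intervalIntegrable (by fun_prop) _ _)
      (Continuous.intervalIntegrable (by fun_prop) _ _) fun t ht => ?_
    exact le_mul_of_one_le_right (pow_nonneg ht.1 n) (Real.one_le_exp ht.1)
  refine le_trans ?_ h1
  rw [integral_pow]
  have h2 : (n.factorial : ℝ) ≤ (n : ℝ) ^ n := by exact_mod_cast n.factorial_le_pow
  have h3 : (n : ℝ) ^ n ≤ κ ^ n := pow_le_pow_left₀ n.cast_nonneg (by linarith) n
  rw [zero_pow (by omega), sub_zero, le_div_iff₀ (by positivity), pow_succ]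
  exact mul_le_mul (h2.trans h3) hκ (by positivity) (by positivity)

/-- Put `m = n + 2`. The negative half-line contributes `κ^m + m!`, since `-t^m = (-t)^m` for odd
`m`; the interval `[0, κ]` contributes `-κ^m + m ∫ t^{m-1} e^t`. One more integration by parts gives
`m κ^{m-1} e^κ + m! - m(m-1) ∫ t^{m-2} e^t`, and the last two terms have nonpositive sum because
that integral is at least `(m-2)!`. -/
theorem integral_exp_mul_gap_le {n : ℕ} (hn : Odd n) {κ : ℝ} (hκ : (n : ℝ) + 1 ≤ κ) :
    ∫ t : ℝ, Real.exp t * max (κ ^ (n + 2) - t ^ (n + 2)) 0 ≤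
      (n + 2) * (κ ^ (n + 1) * Real.exp κ) := by
  have hκ0 : 0 ≤ κ := by linarith [n.cast_nonneg (α := ℝ)]
  have hodd : Odd (n + 2) := by simpa [parity_simps] using hn
  have hcont : Continuous fun t : ℝ => Real.exp t * max (κ ^ (n + 2) - t ^ (n + 2)) 0 := by fun_prop
  obtain ⟨hGi, hG⟩ := integral_Iic_pow_mul_exp (n + 2)
  have hexp : IntegrableOn (fun t : ℝ => κ ^ (n + 2) * Real.exp t) (Iic 0) :=
    (integrableOn_exp_Iic 0).const_mul _
  have hleft : EqOn (fun t : ℝ => Real.exp t * max (κ ^ (n + 2) - t ^ (n + 2)) 0)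
      (fun t => κ ^ (n + 2) * Real.exp t + (-t) ^ (n + 2) * Real.exp t) (Iic 0) := fun t ht => by
    have h1 : 0 ≤ (-t) ^ (n + 2) := pow_nonneg (neg_nonneg.2 ht) _
    have h2 : 0 ≤ κ ^ (n + 2) := pow_nonneg hκ0 _
    rw [hodd.neg_pow] at h1
    simp only
    rw [max_eq_left (by linarith), hodd.neg_pow]
    ring
  have hright : ∀ t ∈ Ioi (0 : ℝ) \ Ioc 0 κ,
      Real.exp t * max (κ ^ (n + 2) - t ^ (n + 2)) 0 = 0 := fun t ht => by
    have h1 : κ < t := by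
      by_contra h
      exact ht.2 ⟨ht.1, not_lt.1 h⟩
    rw [max_eq_right (sub_nonpos.2 (pow_le_pow_left₀ hκ0 h1.le _)), mul_zero]
  have hi1 : IntegrableOn (fun t : ℝ => Real.exp t * max (κ ^ (n + 2) - t ^ (n + 2)) 0) (Iic 0) :=
    (integrableOn_congr_fun hleft measurableSet_Iic).2 (hexp.add hGi)
  have hi2 : IntegrableOn (fun t : ℝ => Real.exp t * max (κ ^ (n + 2) - t ^ (n + 2)) 0) (Ioi 0) :=
    IntegrableOn.of_forall_sdiff_eq_zero (hcont.integrableOn_Ioc (a := 0) (b := κ))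
      measurableSet_Ioi hright
  have hmid : ∫ t in Ioc 0 κ, Real.exp t * max (κ ^ (n + 2) - t ^ (n + 2)) 0 =
      ∫ t in (0 : ℝ)..κ, (κ ^ (n + 2) * Real.exp t - t ^ (n + 2) * Real.exp t) := by
    rw [intervalIntegral.integral_of_le hκ0]
    refine setIntegral_congr_fun measurableSet_Ioc fun t ht => ?_
    rw [max_eq_left (sub_nonneg.2 (pow_le_pow_left₀ ht.1.le ht.2 _))]
    ring
  have h1 := integral_pow_succ_mul_exp (n + 1) κ
  have h2 := integral_pow_succ_mul_exp n κ
  have h3 := factorial_le_integral_pow_mul_exp n hκ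
  rw [← intervalIntegral.integral_Iic_add_Ioi hi1 hi2, setIntegral_congr_fun measurableSet_Iic hleft,
    integral_add hexp hGi, hG, integral_const_mul, integral_exp_Iic,
    setIntegral_eq_of_subset_of_forall_sdiff_eq_zero measurableSet_Ioi
      (fun t ht => ht.1 : Ioc 0 κ ⊆ Ioi 0) hright, hmid,
    intervalIntegral.integral_sub (Continuous.intervalIntegrable (by fun_prop) _ _)
      (Continuous.intervalIntegrable (by fun_prop) _ _), intervalIntegral.integral_const_mul,
    integral_exp, Nat.factorial_succ, Nat.factorial_succ]
  rw [h1, h2]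
  push_cast
  have h4 := mul_le_mul_of_nonneg_left h3 (show (0 : ℝ) ≤ ((n : ℝ) + 2) * (n + 1) by positivity)
  simp only [Real.exp_zero]
  linarith

theorem sphereArea_eq (N : ℕ) : sphereArea N = N * volume.real (Metric.ball (0 : E N) 1) := by
  rw [sphereArea, Measure.toSphere_real_apply_univ, finrank_euclideanSpace_fin]

theorem sphereArea_pos (hN : 1 ≤ N) : 0 < sphereArea N := by
  rw [sphereArea_eq]
  have : 0 < volume.real (Metric.ball (0 : E N) 1) :=
    ENNReal.toReal_pos (Metric.measure_ball_pos _ _ one_pos).ne' measure_ball_lt_top.ne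
  positivity

theorem aConst_pos (hN : 1 ≤ N) (hm : m ≠ 0) : 0 < aConst N m := by
  have := sphereArea_pos hN
  have : (0 : ℝ) < N := by exact_mod_cast hN
  unfold aConst
  positivity

/-- Integration in polar coordinates with a logarithmic radial variable. -/
theorem integral_fun_norm_eq_integral_exp (hN : 1 ≤ N) (g : ℝ → ℝ) :
    ∫ ξ : E N, g ‖ξ‖ = sphereArea N / N * ∫ t : ℝ, Real.exp t * g (Real.exp (t / N)) := by
  have := nontrivial_E hN
  have hN0 : (0 : ℝ) < N := by exact_mod_cast hN
  have himg : (fun t : ℝ => Real.exp (t / N)) '' univ = Ioi 0 := by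
    ext y
    simp only [image_univ, mem_range, mem_Ioi]
    refine ⟨fun ⟨t, ht⟩ => ht ▸ Real.exp_pos _, fun hy => ⟨N * Real.log y, ?_⟩⟩
    rw [mul_div_cancel_left₀ _ hN0.ne', Real.exp_log hy]
  have hinj : InjOn (fun t : ℝ => Real.exp (t / N)) univ := fun a _ b _ h => by
    have := Real.exp_injective h
    field_simp at this
    exact this
  have hder : ∀ t ∈ (univ : Set ℝ), HasDerivWithinAt (fun t : ℝ => Real.exp (t / N))
      (Real.exp (t / N) * (1 / N)) univ t := fun t _ =>
    (((hasDerivAt_id t).div_const (N : ℝ)).exp).hasDerivWithinAt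
  rw [integral_fun_norm_addHaar volume g, finrank_euclideanSpace_fin, ← himg,
    integral_image_eq_integral_abs_deriv_smul MeasurableSet.univ hder hinj, setIntegral_univ,
    sphereArea_eq, nsmul_eq_mul, smul_eq_mul, mul_div_cancel_left₀ _ hN0.ne',
    mul_left_comm, ← integral_const_mul]
  congr 2; ext t
  rw [abs_of_pos (by positivity), smul_eq_mul, smul_eq_mul]
  have h1 : Real.exp t = Real.exp (t / N) ^ (N - 1) * Real.exp (t / N) := by
    rw [← pow_succ, Nat.sub_add_cancel hN, ← Real.exp_nat_mul, mul_div_cancel₀ _ hN0.ne']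
  rw [h1]
  field_simp

/-- With `r = e^{t/N}` the symbol becomes `(2/N)^m t^m`, so `(2/N)^m` factors out of the gap. The
remaining constants `(2π)^{-N} (ω_N/N) (2/N)^m m` combine to `1/a_m`. -/
theorem integral_levelGap_le (hN : 1 ≤ N) (hm : Odd m) (hm2 : 2 ≤ m) {κ : ℝ}
    (hκ : (m : ℝ) - 1 ≤ κ) :
    ((2 * Real.pi) ^ N)⁻¹ * ∫ ξ : E N, levelGap m ((2 / N) ^ m * κ ^ m) ‖ξ‖ ≤
      κ ^ (m - 1) * Real.exp κ / aConst N m := by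
  have hN0 : (0 : ℝ) < N := by exact_mod_cast hN
  obtain ⟨n, rfl⟩ : ∃ n, m = n + 2 := ⟨m - 2, by omega⟩
  have hn : Odd n := by simpa [parity_simps] using hm
  have h1 : ∀ t : ℝ, levelGap (n + 2) ((2 / N) ^ (n + 2) * κ ^ (n + 2)) (Real.exp (t / N)) =
      (2 / N) ^ (n + 2) * max (κ ^ (n + 2) - t ^ (n + 2)) 0 := fun t => by
    rw [levelGap, symbol, Real.log_exp, mul_max_of_nonneg _ _ (by positivity), mul_zero, mul_sub,
      ← mul_pow _ t]
    congr 3; ring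
  have h2 := integral_exp_mul_gap_le hn (κ := κ) (by push_cast at hκ; linarith)
  have h3 : ∫ t : ℝ, Real.exp t *
      levelGap (n + 2) ((2 / N) ^ (n + 2) * κ ^ (n + 2)) (Real.exp (t / N)) =
      (2 / N) ^ (n + 2) * ∫ t : ℝ, Real.exp t * max (κ ^ (n + 2) - t ^ (n + 2)) 0 := by
    rw [← integral_const_mul]
    congr 1; ext t
    rw [h1]; ring
  have hω := sphereArea_pos hN
  rw [integral_fun_norm_eq_integral_exp hN, h3]
  calc _ ≤ ((2 * Real.pi) ^ N)⁻¹ * (sphereArea N / N * ((2 / N) ^ (n + 2) *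
        ((n + 2) * (κ ^ (n + 1) * Real.exp κ)))) := by gcongr
    _ = _ := by
      rw [aConst, show n + 2 - 1 = n + 1 from rfl]
      push_cast
      rw [div_pow]
      field_simp
      ring

end LogLap

/-! ### The numbers `τ̃_m` and `τ₀`, and the bound (ii) -/

namespace LogLap

variable {N m : ℕ}

theorem continuousOn_hFun (hm : 2 ≤ m) : ContinuousOn (hFun m) (Ici 1) := by
  have hm1 : (0 : ℝ) < (m : ℝ) - 1 := by
    have : (2 : ℝ) ≤ m := by exact_mod_cast hm
    linarith
  unfold hFun
  refine ContinuousOn.sub ?_ (ContinuousOn.log (by fun_prop) fun x hx => ?_)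
  · exact ((Real.continuous_rpow_const (by positivity)).comp
      (continuous_id.div_const 3)).continuousOn
  · have : (1 : ℝ) ≤ x := hx
    positivity

/-- The logarithm is negligible against any positive power, and `τ/3 ≥ (τ + e)/6` once `τ ≥ e`. -/
theorem eventually_hFun_pos (hm : 2 ≤ m) : ∀ᶠ τ in atTop, 0 < hFun m τ := by
  have hm1 : (0 : ℝ) < (m : ℝ) - 1 := by
    have : (2 : ℝ) ≤ m := by exact_mod_cast hm
    linarith
  set c : ℝ := 1 / ((m : ℝ) - 1) with hc
  have hc0 : 0 < c := by positivity
  have h6 : (0 : ℝ) < (1 / 6 : ℝ) ^ c := by positivity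
  have h1 := (isLittleO_log_rpow_atTop hc0).def (half_pos h6)
  have h2 := (tendsto_atTop_add_const_right atTop (Real.exp 1) tendsto_id).eventually h1
  filter_upwards [h2, eventually_ge_atTop (Real.exp 1)] with τ hτ hτe
  have hτ0 : 0 < τ := (Real.exp_pos 1).trans_le hτe
  have hp : 0 < (τ + Real.exp 1) ^ c := by positivity
  simp only [id, Real.norm_eq_abs] at hτ
  rw [abs_of_pos hp] at hτ
  have h3 : (1 / 6 : ℝ) ^ c * (τ + Real.exp 1) ^ c ≤ (τ / 3) ^ c := by
    rw [← Real.mul_rpow (by norm_num) (by positivity)]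
    exact Real.rpow_le_rpow (by positivity) (by linarith) hc0.le
  have h4 := le_abs_self (Real.log (τ + Real.exp 1))
  have h5 : 0 < (1 / 6 : ℝ) ^ c * (τ + Real.exp 1) ^ c := by positivity
  rw [hFun, ← hc]
  linarith

/-- The set where `h_m ≤ 0` on `[1, ∞)` is compact and contains `1`, so it has a greatest point.
There `h_m` vanishes by continuity from the right, and the point is not `1` because `h_m(1) < 0`. -/
theorem exists_isTauTilde (hm : 2 ≤ m) : ∃ t, IsTauTilde m t := by
  have hm1 : (0 : ℝ) < (m : ℝ) - 1 := by
    have : (2 : ℝ) ≤ m := by exact_mod_cast hm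
    linarith
  obtain ⟨T, hT⟩ := eventually_atTop.1 (eventually_hFun_pos hm)
  have hone : hFun m 1 < 0 := by
    have h1 : (1 / 3 : ℝ) ^ (1 / ((m : ℝ) - 1)) ≤ 1 :=
      Real.rpow_le_one (by norm_num) (by norm_num) (by positivity)
    have h2 : 1 < Real.log (1 + Real.exp 1) := by
      rw [Real.lt_log_iff_exp_lt (by positivity)]
      linarith
    rw [hFun]
    linarith
  have hcont := continuousOn_hFun hm
  have hcomp : IsCompact (Icc 1 T ∩ hFun m ⁻¹' Iic 0) :=
    isCompact_Icc.of_isClosed_subset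
      ((hcont.mono Icc_subset_Ici_self).preimage_isClosed_of_isClosed isClosed_Icc isClosed_Iic)
      inter_subset_left
  have hmem : ∀ τ, 1 ≤ τ → hFun m τ ≤ 0 → τ ∈ Icc 1 T ∩ hFun m ⁻¹' Iic 0 := fun τ h1 h2 =>
    ⟨⟨h1, le_of_not_gt fun h => (hT τ h.le).not_ge h2⟩, h2⟩
  obtain ⟨t, ⟨⟨ht1, -⟩, ht0⟩, hmax⟩ := hcomp.exists_isGreatest ⟨1, hmem 1 le_rfl hone.le⟩
  have hpos : ∀ τ, t < τ → 0 < hFun m τ := fun τ hτ => by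
    by_contra h
    exact hτ.not_ge (hmax (hmem τ (ht1.trans hτ.le) (not_lt.1 h)))
  have hzero : hFun m t = 0 := by
    refine le_antisymm ht0 ?_
    have h1 : Tendsto (hFun m) (𝓝[>] t) (𝓝 (hFun m t)) :=
      (hcont t ht1).mono_left (nhdsWithin_mono _ fun x hx => ht1.trans (le_of_lt hx))
    refine ge_of_tendsto h1 ?_
    filter_upwards [self_mem_nhdsWithin] with τ hτ
    exact (hpos τ hτ).le
  refine ⟨t, lt_of_le_of_ne ht1 ?_, hzero, hpos⟩
  rintro rfl
  exact hone.ne hzero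

/-- Intermediate values of `x^{m-1} e^x` on `[1, M]`, where `M = max {e, τ̃_m}`: the value at `1` is
`e ≤ M` and the value at `M` is at least `M`. -/
theorem exists_isTauZero (hm : 2 ≤ m) : ∃ τ₀, IsTauZero m τ₀ := by
  obtain ⟨t, ht⟩ := exists_isTauTilde hm
  set M := max (Real.exp 1) t
  have hM1 : 1 ≤ M := (Real.one_le_exp zero_le_one).trans (le_max_left _ _)
  have hM : M ≤ M ^ (m - 1) * Real.exp M := by
    have h1 := one_le_pow₀ hM1 (n := m - 1)
    have h2 := Real.add_one_le_exp M
    nlinarith [Real.exp_pos M]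
  obtain ⟨τ, hτ, h⟩ := intermediate_value_Icc (f := fun x : ℝ => x ^ (m - 1) * Real.exp x) hM1
    (by fun_prop) (show M ∈ Icc _ _ from ⟨by simp [M], hM⟩)
  exact ⟨τ, hτ.1, t, ht, h⟩

/-- From `κ ≤ e^{κ-1}` the left side is at most the exponential of `(m-1)(κ-1) + κ ≤ κ² ≤ κ^m`. -/
theorem pow_mul_exp_le_exp_pow {κ : ℝ} (hm : 3 ≤ m) (hκ : (m : ℝ) - 1 ≤ κ) :
    κ ^ (m - 1) * Real.exp κ ≤ Real.exp (κ ^ m) := by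
  have hm3 : (3 : ℝ) ≤ m := by exact_mod_cast hm
  have hκ0 : 0 < κ := by linarith
  have h1 : κ ^ (m - 1) ≤ Real.exp (((m - 1 : ℕ) : ℝ) * (κ - 1)) := by
    rw [Real.exp_nat_mul]
    refine pow_le_pow_left₀ hκ0.le ?_ _
    linarith [Real.add_one_le_exp (κ - 1)]
  have h2 : κ ^ 2 ≤ κ ^ m := pow_le_pow_right₀ (by linarith) (by omega)
  rw [Nat.cast_sub (by omega), Nat.cast_one] at h1
  calc κ ^ (m - 1) * Real.exp κ ≤ Real.exp (((m : ℝ) - 1) * (κ - 1)) * Real.exp κ := by gcongr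
    _ = Real.exp (((m : ℝ) - 1) * (κ - 1) + κ) := (Real.exp_add _ _).symm
    _ ≤ Real.exp (κ ^ m) := by
      refine Real.exp_le_exp.2 (le_trans ?_ h2)
      nlinarith

theorem dConst_pos (hN : 1 ≤ N) (hm : 2 ≤ m) (τ₀ : ℝ) : 0 < dConst N m τ₀ := by
  have ha := aConst_pos hN (show m ≠ 0 by omega)
  have hm1 : (0 : ℝ) < (m : ℝ) - 1 := by
    have : (2 : ℝ) ≤ m := by exact_mod_cast hm
    linarith
  refine lt_max_of_lt_left ?_
  positivity

/-- The two entries of the maximum correspond to the position of `κ`. If `κ ≤ τ₀`, replacing `e^κ`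
by `e^{τ₀}` gives the first. If `κ ≥ τ₀`, then `2e^{κ^m} - τ₀^{m-1} e^{τ₀} ≥ 2κ^{m-1} e^κ - κ^{m-1}
e^κ` gives the second. -/
theorem pow_mul_exp_div_le_dConst (hN : 1 ≤ N) (hm : 3 ≤ m) {κ : ℝ} (hκ : (m : ℝ) - 1 ≤ κ)
    (hκm : κ ^ m = ((m : ℝ) - 1) ^ m + 1 / 2 ^ m) {τ₀ : ℝ} (hτ : 1 ≤ τ₀) :
    κ ^ (m - 1) * Real.exp κ / aConst N m ≤ dConst N m τ₀ := by
  have ha := aConst_pos hN (show m ≠ 0 by omega)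
  have hm3 : (3 : ℝ) ≤ m := by exact_mod_cast hm
  have hκ0 : 0 < κ := by linarith
  rw [dConst, ← hκm]
  rcases le_total κ τ₀ with h | h
  · refine le_max_of_le_left ?_
    have h1 : (κ ^ m) ^ (((m : ℝ) - 1) / m) = κ ^ (m - 1) := by
      rw [← Real.rpow_natCast κ m, ← Real.rpow_mul hκ0.le, mul_div_cancel₀ _ (by positivity),
        ← Real.rpow_natCast κ (m - 1), Nat.cast_sub (by omega), Nat.cast_one]
    rw [h1, div_mul_eq_mul_div, mul_comm]
    gcongr
  · refine le_max_of_le_right ?_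
    rw [one_div, ← div_eq_inv_mul]
    have h1 := pow_mul_exp_le_exp_pow hm hκ
    have h2 : τ₀ ^ (m - 1) * Real.exp τ₀ ≤ κ ^ (m - 1) * Real.exp κ := by
      gcongr
    gcongr
    linarith

theorem bConst_sub_le_firstEigenvalue (hN : 1 ≤ N) (hm : 3 ≤ m) (hodd : Odd m) {τ₀ d : ℝ}
    (hτ : 1 ≤ τ₀) (hd : dConst N m τ₀ ≤ d) {Ω : Set (E N)} (hΩ : IsBoundedOpen Ω) :
    bConst N m - d * volume.real Ω ≤ firstEigenvalue m Ω := by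
  have hm3 : (3 : ℝ) ≤ m := by exact_mod_cast hm
  have hN0 : (0 : ℝ) < N := by exact_mod_cast hN
  have hK : 0 ≤ ((m : ℝ) - 1) ^ m + 1 / 2 ^ m := by
    have : (0 : ℝ) ≤ ((m : ℝ) - 1) ^ m := pow_nonneg (by linarith) _
    positivity
  -- This `κ` makes `b_m` exactly the level `(2/N)^m κ^m`, so the gap estimate applies at `s = b_m`;
  -- the summand `2^{-m}` also keeps `κ ≥ m - 1`.
  obtain ⟨κ, hκ0, hκm⟩ : ∃ κ : ℝ, 0 ≤ κ ∧ κ ^ m = ((m : ℝ) - 1) ^ m + 1 / 2 ^ m :=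
    ⟨_, Real.rpow_nonneg hK _, Real.rpow_inv_natCast_pow hK (by omega)⟩
  have hκ : (m : ℝ) - 1 ≤ κ := by
    refine le_of_pow_le_pow_left₀ (show m ≠ 0 by omega) hκ0 ?_
    rw [hκm]
    have : (0 : ℝ) < 1 / 2 ^ m := by positivity
    linarith
  have hb : bConst N m = (2 / N) ^ m * κ ^ m := by
    rw [bConst, hκm, div_pow]
    field_simp
  have h1 := le_firstEigenvalue hN (show m ≠ 0 by omega) hΩ (bConst N m)
  have h2 := integral_levelGap_le hN hodd (by omega) hκ
  rw [← hb] at h2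
  have h3 := (h2.trans (pow_mul_exp_div_le_dConst hN hm hκ hκm hτ)).trans hd
  have h4 := mul_le_mul_of_nonneg_right h3 (measureReal_nonneg (μ := volume) (s := Ω))
  linarith

/-! ### Even order and small sets: the statements in (i) -/

theorem volume_real_ball (x : E N) {r : ℝ} (hr : 0 < r) :
    volume.real (Metric.ball x r) = r ^ N * volume.real (Metric.ball (0 : E N) 1) := by
  rw [Measure.real, Measure.addHaar_ball_of_pos volume x hr, finrank_euclideanSpace_fin,
    ENNReal.toReal_mul, ENNReal.toReal_ofReal (by positivity), Measure.real]

/-- A lower bound for the first eigenvalue with constants independent of `Ω`. -/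
theorem exists_symbol_mul_sub_le_firstEigenvalue (hN : 1 ≤ N) (hm : m ≠ 0) :
    ∃ c c' : ℝ, ∀ Ω : Set (E N), IsBoundedOpen Ω → ∀ R : ℝ, 1 ≤ R →
      symbol m R * (1 - c * (R ^ N * volume.real Ω)) - c' * volume.real Ω ≤
        firstEigenvalue m Ω := by
  set v₁ : ℝ := volume.real (Metric.ball (0 : E N) 1)
  set A : ℝ := ∫ ξ : E N, (Iio (1 : ℝ)).indicator (fun r => |symbol m r|) ‖ξ‖
  refine ⟨((2 * Real.pi) ^ N)⁻¹ * v₁, ((2 * Real.pi) ^ N)⁻¹ * A, fun Ω hΩ R hR => ?_⟩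
  have hs : 0 ≤ symbol m R := pow_nonneg (mul_nonneg zero_le_two (Real.log_nonneg hR)) m
  have hind := integrable_indicator_symbol (N := N) (m := m) hN hm
  have hconst : Integrable ((Metric.ball (0 : E N) R).indicator fun _ => symbol m R) :=
    (integrable_indicator_iff measurableSet_ball).2 (integrableOn_const measure_ball_lt_top.ne)
  -- For `‖ξ‖ ≥ R` there is no gap; for `1 ≤ ‖ξ‖ < R` it is at most `symbol m R`, and inside the
  -- unit ball the negative part of the symbol may add to it.
  have hgap : ∫ ξ : E N, levelGap m (symbol m R) ‖ξ‖ ≤ symbol m R * (R ^ N * v₁) + A := by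
    have h1 : ∫ ξ : E N, levelGap m (symbol m R) ‖ξ‖ ≤
        ∫ ξ : E N, ((Metric.ball (0 : E N) R).indicator (fun _ => symbol m R) ξ +
          (Iio (1 : ℝ)).indicator (fun r => |symbol m r|) ‖ξ‖) := by
      refine integral_mono (integrable_levelGap hN hm _) (hconst.add hind) fun ξ => ?_
      have h2 : 0 ≤ (Metric.ball (0 : E N) R).indicator (fun _ => symbol m R) ξ :=
        indicator_nonneg (fun _ _ => hs) _
      have h3 : 0 ≤ (Iio (1 : ℝ)).indicator (fun r => |symbol m r|) ‖ξ‖ :=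
        indicator_nonneg (fun _ _ => abs_nonneg _) _
      refine max_le ?_ (add_nonneg h2 h3)
      rcases lt_or_ge ‖ξ‖ R with hξ | hξ
      · rw [indicator_of_mem (by simpa using hξ)]
        rcases lt_or_ge ‖ξ‖ 1 with h | h
        · rw [indicator_of_mem (by exact h)]
          linarith [neg_abs_le (symbol m ‖ξ‖)]
        · have : 0 ≤ symbol m ‖ξ‖ := pow_nonneg (mul_nonneg zero_le_two (Real.log_nonneg h)) m
          linarith
      · have : symbol m R ≤ symbol m ‖ξ‖ := by
          refine pow_le_pow_left₀ (mul_nonneg zero_le_two (Real.log_nonneg hR)) ?_ m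
          have := Real.log_le_log (by linarith) hξ
          linarith
        linarith
    have h4 : volume.real (Metric.ball (0 : E N) R) = R ^ N * v₁ :=
      volume_real_ball 0 (by linarith)
    rw [integral_add hconst hind, integral_indicator measurableSet_ball] at h1
    simp only [integral_const, smul_eq_mul, measureReal_restrict_apply, MeasurableSet.univ,
      univ_inter, h4] at h1
    linarith
  have h5 := le_firstEigenvalue hN hm hΩ (symbol m R)
  have h6 : 0 ≤ ((2 * Real.pi) ^ N)⁻¹ * volume.real Ω := by positivity
  have h7 := mul_le_mul_of_nonneg_left hgap h6
  linarith

theorem firstEigenvalue_nonneg_of_even (hN : 1 ≤ N) (hm : m ≠ 0) (heven : Even m)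
    {Ω : Set (E N)} (hΩ : IsBoundedOpen Ω) : 0 ≤ firstEigenvalue m Ω := by
  have h := le_firstEigenvalue hN hm hΩ 0
  have h1 : ∀ r, levelGap m 0 r = 0 := fun r =>
    max_eq_right (by rw [zero_sub, neg_nonpos]; exact heven.pow_nonneg _)
  simpa [h1] using h

/-- At `R = e` the uniform lower bound tends to `2^m > 0` as the volume tends to zero, and a small
enclosing ball forces a small volume. -/
theorem exists_radius_firstEigenvalue_nonneg (hN : 1 ≤ N) (hm : m ≠ 0) :
    ∃ r₀ : ℝ, 0 < r₀ ∧ ∀ (x₀ : E N) (Ω : Set (E N)), IsBoundedOpen Ω →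
      Ω ⊆ Metric.ball x₀ r₀ → 0 ≤ firstEigenvalue m Ω := by
  obtain ⟨c, c', h⟩ := exists_symbol_mul_sub_le_firstEigenvalue (m := m) hN hm
  have hsymb : symbol m (Real.exp 1) = 2 ^ m := by simp [symbol]
  have hcont : Tendsto (fun V : ℝ => (2 : ℝ) ^ m * (1 - c * (Real.exp 1 ^ N * V)) - c' * V) (𝓝 0)
      (𝓝 (2 ^ m)) := by
    have : Continuous fun V : ℝ => (2 : ℝ) ^ m * (1 - c * (Real.exp 1 ^ N * V)) - c' * V := by
      fun_prop
    simpa using this.tendsto 0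
  obtain ⟨ε, hε, hV⟩ := Metric.eventually_nhds_iff.1
    (hcont.eventually (lt_mem_nhds (show (0 : ℝ) < 2 ^ m by positivity)))
  have hvol : Tendsto (fun r : ℝ => r ^ N * volume.real (Metric.ball (0 : E N) 1)) (𝓝[>] 0)
      (𝓝 0) := by
    have : Continuous fun r : ℝ => r ^ N * volume.real (Metric.ball (0 : E N) 1) := by fun_prop
    have h0 := this.tendsto 0
    rw [zero_pow (by omega), zero_mul] at h0
    exact h0.mono_left nhdsWithin_le_nhds
  obtain ⟨r, hr, hr0⟩ := ((hvol.eventually (gt_mem_nhds hε)).and self_mem_nhdsWithin).exists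
  have hr0' : 0 < r := hr0
  refine ⟨r, hr0, fun x₀ Ω hΩ hsub => ?_⟩
  have h1 : volume.real Ω ≤ r ^ N * volume.real (Metric.ball (0 : E N) 1) :=
    (measureReal_mono hsub measure_ball_lt_top.ne).trans_eq (volume_real_ball x₀ hr0')
  have h2 := h Ω hΩ (Real.exp 1) (Real.one_le_exp zero_le_one)
  rw [hsymb] at h2
  refine (le_of_lt (hV ?_)).trans h2
  rw [Real.dist_eq, sub_zero, abs_of_pos hΩ.volume_real_pos]
  linarith

theorem tendsto_log_inv_mul_neg_log :
    Tendsto (fun V : ℝ => Real.log (1 / (V * (-Real.log V)))) (𝓝[>] 0) atTop := by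
  have h1 : Tendsto (fun V : ℝ => V * (-Real.log V)) (𝓝[>] 0) (𝓝[>] 0) := by
    refine tendsto_nhdsWithin_iff.2 ⟨?_, ?_⟩
    · have := (Real.continuous_mul_log.tendsto 0).neg
      simp only [zero_mul, neg_zero] at this
      exact (this.mono_left nhdsWithin_le_nhds).congr fun V => by ring
    · filter_upwards [Ioo_mem_nhdsGT (zero_lt_one (α := ℝ))] with V hV
      exact mul_pos hV.1 (neg_pos.2 (Real.log_neg hV.1 hV.2))
  simp only [one_div]
  exact Real.tendsto_log_atTop.comp (tendsto_inv_nhdsGT_zero.comp h1)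

/-- The radius must satisfy `R^N |Ω| → 0` so that the loss disappears, while `log R` stays
asymptotically optimal; the factor `-log |Ω|` inside the logarithm achieves the first. -/
theorem le_liminf_firstEigenvalue (hN : 1 ≤ N) (hm : m ≠ 0) :
    (((2 / (N : ℝ)) ^ m : ℝ) : EReal) ≤
      liminf
        (fun Ω : Set (E N) =>
          ((firstEigenvalue m Ω *
            Real.log (1 / (volume.real Ω * (-Real.log (volume.real Ω)))) ^ (-(m : ℤ)) : ℝ) : EReal))
        (comap (fun Ω : Set (E N) => volume.real Ω) (𝓝[>] 0) ⊓
          𝓟 {Ω : Set (E N) | IsBoundedOpen Ω}) := by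
  obtain ⟨c, c', h⟩ := exists_symbol_mul_sub_le_firstEigenvalue (m := m) hN hm
  have hN0 : (0 : ℝ) < N := by exact_mod_cast hN
  have hLlim := tendsto_log_inv_mul_neg_log
  set L : ℝ → ℝ := fun V => Real.log (1 / (V * (-Real.log V))) with hL
  set g : ℝ → ℝ := fun V => (2 / (N : ℝ)) ^ m * (1 - c * (-Real.log V)⁻¹) - c' * V * (L V ^ m)⁻¹
  have hg : Tendsto g (𝓝[>] 0) (𝓝 ((2 / (N : ℝ)) ^ m)) := by
    have h1 : Tendsto (fun V : ℝ => (-Real.log V)⁻¹) (𝓝[>] 0) (𝓝 0) :=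
      tendsto_inv_atTop_zero.comp (tendsto_neg_atBot_atTop.comp Real.tendsto_log_nhdsGT_zero)
    have h2 : Tendsto (fun V : ℝ => (L V ^ m)⁻¹) (𝓝[>] 0) (𝓝 0) :=
      tendsto_inv_atTop_zero.comp ((tendsto_pow_atTop hm).comp hLlim)
    have h3 : Tendsto (fun V : ℝ => V) (𝓝[>] 0) (𝓝 0) := nhdsWithin_le_nhds
    have := (((h1.const_mul c).const_sub 1).const_mul ((2 / (N : ℝ)) ^ m)).sub
      ((h3.const_mul c').mul h2)
    simp only [mul_zero, sub_zero, mul_one] at this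
    exact this
  have hle : ∀ᶠ V in 𝓝[>] (0 : ℝ), ∀ Ω : Set (E N), IsBoundedOpen Ω → volume.real Ω = V →
      g V ≤ firstEigenvalue m Ω * L V ^ (-(m : ℤ)) := by
    filter_upwards [hLlim.eventually (eventually_gt_atTop 0),
      Ioo_mem_nhdsGT (zero_lt_one (α := ℝ))] with V hLV hV Ω hΩ hΩV
    have hlog : 0 < -Real.log V := neg_pos.2 (Real.log_neg hV.1 hV.2)
    -- With this radius `R^N V = 1/(-log V)`, and the symbol at `R` equals `(2/N)^m L^m`, the
    -- normalising power.
    have h1 := h Ω hΩ (Real.exp (L V / N)) (Real.one_le_exp (by positivity))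
    have h2 : Real.exp (L V / N) ^ N * V = (-Real.log V)⁻¹ := by
      rw [← Real.exp_nat_mul, mul_div_cancel₀ _ hN0.ne', hL]
      simp only
      rw [Real.exp_log (by have := hV.1; positivity)]
      have := hV.1.ne'
      field_simp
    have h3 : symbol m (Real.exp (L V / N)) = (2 / N) ^ m * L V ^ m := by
      rw [symbol, Real.log_exp, ← mul_pow]
      congr 1; ring
    rw [hΩV, h2, h3] at h1
    rw [zpow_neg, zpow_natCast, ← div_eq_mul_inv, le_div_iff₀ (by positivity)]
    refine le_of_eq_of_le ?_ h1
    simp only [g]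
    have : L V ^ m ≠ 0 := by positivity
    rw [sub_mul, mul_assoc (c' * V), inv_mul_cancel₀ this]
    ring
  refine le_of_forall_lt_imp_le_of_dense fun a ha => ?_
  have hga := ((continuous_coe_real_ereal.tendsto _).comp hg).eventually (lt_mem_nhds ha)
  refine le_liminf_of_le (by isBoundedDefault) ?_
  rw [eventually_inf_principal]
  filter_upwards [(hga.and hle).comap (fun Ω : Set (E N) => volume.real Ω)] with Ω hV hΩ
  exact hV.1.le.trans (EReal.coe_le_coe_iff.2 (hV.2 Ω hΩ rfl))

end LogLap

open LogLap in
theorem corollary4p1 (N m : ℕ) (hN : 1 ≤ N) (hm : 2 ≤ m) :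
    -- the first eigenvalue exists: it is attained, not a default value
    (∀ Ω : Set (E N), IsBoundedOpen Ω →
      IsLeast {μ : ℝ | IsEigenvalue m Ω μ} (firstEigenvalue m Ω)) ∧
    -- (i)
    (Even m → ∀ Ω : Set (E N), IsBoundedOpen Ω → 0 ≤ firstEigenvalue m Ω) ∧
    (Odd m → ∃ r₀ : ℝ, 0 < r₀ ∧ ∀ (x₀ : E N) (Ω : Set (E N)), IsBoundedOpen Ω →
      Ω ⊆ Metric.ball x₀ r₀ → 0 ≤ firstEigenvalue m Ω) ∧
    ((((2 / (N : ℝ)) ^ m : ℝ) : EReal) ≤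
      liminf
        (fun Ω : Set (E N) =>
          ((firstEigenvalue m Ω *
            Real.log (1 / (volume.real Ω * (-Real.log (volume.real Ω)))) ^ (-(m : ℤ)) : ℝ) : EReal))
        (comap (fun Ω : Set (E N) => volume.real Ω) (𝓝[>] 0) ⊓
          𝓟 {Ω : Set (E N) | IsBoundedOpen Ω})) ∧
    -- (ii)
    (Odd m → ∃ τ₀ : ℝ, IsTauZero m τ₀ ∧ 0 < dConst N m τ₀ ∧
      ∀ d : ℝ, dConst N m τ₀ ≤ d → ∀ Ω : Set (E N), IsBoundedOpen Ω →
        firstEigenvalue m Ω < 0 →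
          bConst N m - d * volume.real Ω ≤ firstEigenvalue m Ω) := by
  have hm0 : m ≠ 0 := by omega
  refine ⟨fun Ω hΩ => isLeast_firstEigenvalue hN hm0 hΩ,
    fun heven Ω hΩ => firstEigenvalue_nonneg_of_even hN hm0 heven hΩ,
    fun _ => exists_radius_firstEigenvalue_nonneg hN hm0,
    le_liminf_firstEigenvalue hN hm0, fun hodd => ?_⟩
  have hm3 : 3 ≤ m := by
    obtain ⟨k, hk⟩ := hodd
    omega
  obtain ⟨τ₀, hτ₀⟩ := exists_isTauZero hm
  exact ⟨τ₀, hτ₀, dConst_pos hN hm τ₀, fun d hd Ω hΩ _ =>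
    bConst_sub_le_firstEigenvalue hN hm3 hodd hτ₀.1 hd hΩ⟩
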